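/- For $\mu>0$ put $g_\mu(x,s)=\dfrac{x^{\mu-1}}{s^{\mu}\,\Gamma(\mu)}\,e^{-x/s}$, $x,s>0$ (the generalized Gamma density $\tilde g^{\gamma}_{\mu}$ with $\gamma=1$, i.e. the law of a $2\mu$-dimensional squared Bessel process started at $0$, run at half speed). Let $\nu\in(0,1]$, let $(\tau_x)_{x\ge 0}$ be a $\nu$-stable subordinator, i.e. a non-decreasing Lévy process with $E\,e^{-\lambda\tau_x}=e^{-x\lambda^{\nu}}$, $\lambda>0$ (so $\tau_x=x$ if $\nu=1$), and let $L_t=\inf\{x\ge 0:\tau_x>t\}$ be its inverse. Define $$\tilde u^{\mu}_{\nu}(x,t)=\int_0^\infty g_\mu(x,s)\,\Pr\{L_t\in ds\},\qquad x>0,\ t>0,$$ which equals $\int_0^\infty g_\mu(x,s)\,l_\nu(s,t)\,ds$ with $l_\nu(\cdot,t)$ the density of $L_t$ if $\nu<1$, and equals $g_\mu(x,t)$ if $\nu=1$. Then, for each $t>0$, $\tilde u^\mu_\nu(\cdot,t)$ is given by a convergent integral and is twice continuously differentiable on $(0,\infty)$, and for all $x>0$, $t>0$ $$\frac{\partial^{\nu}}{\partial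 t^{\nu}}\tilde u^{\mu}_{\nu}(x,t)=\Big(x\,\frac{\partial^2}{\partial x^2}-(\mu-2)\,\frac{\partial}{\partial x}\Big)\tilde u^{\mu}_{\nu}(x,t).$$ Here, for $\nu=1$, $\partial^\nu/\partial t^\nu$ is the ordinary derivative. For $\nu\in(0,1)$ the equation holds both with the Dzherbashyan–Caputo derivative $\frac{1}{\Gamma(1-\nu)}\int_0^t (t-s)^{-\nu}\,\partial_s \tilde u^\mu_\nu(x,s)\,ds$ and with the Riemann–Liouville derivative $\frac{1}{\Gamma(1-\nu)}\frac{\partial}{\partial t}\int_0^t (t-s)^{-\nu}\,\tilde u^\mu_\nu(x,s)\,ds$, both of which exist. -/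

import Mathlib

open MeasureTheory ProbabilityTheory Set Filter Topology
open scoped NNReal

noncomputable section

/-- The generalized Gamma density
`g^γ_μ(x,t) = |γ| x^{γμ-1} / (t^{γμ} Γ(μ)) · exp(-x^γ / t^γ)`, for `x, t > 0`. -/
def genGamma (γ μ x t : ℝ) : ℝ :=
  |γ| * (x ^ (γ * μ - 1) / (t ^ (γ * μ) * Real.Gamma μ)) * Real.exp (-(x ^ γ / t ^ γ))

/-- The time-changed density `g̃^γ_μ(x,t) = g^γ_μ(x, t^{1/γ})`. -/
def genGammaTilde (γ μ x t : ℝ) : ℝ := genGamma γ μ x (t ^ (1 / γ))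

/-- `τ` is a `ν`-stable subordinator: an almost surely non-decreasing, right-continuous process
started at `0`, with independent and stationary increments, and with
`E exp(-λ τ_t) = exp(-t λ^ν)`. For `ν = 1` this is the elementary subordinator `τ_t = t`. -/
structure IsStableSubordinator {Ω : Type*} [MeasurableSpace Ω] (ν : ℝ)
    (τ : ℝ≥0 → Ω → ℝ) (P : Measure Ω) : Prop where
  measurable : ∀ t, Measurable (τ t)
  start_zero : ∀ᵐ ω ∂P, τ 0 ω = 0
  monotone : ∀ᵐ ω ∂P, Monotone fun t => τ t ω
  rightCont : ∀ᵐ ω ∂P, ∀ t, ContinuousWithinAt (fun s => τ s ω) (Ici t) t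
  indep : HasIndepIncrements τ P
  stationary : ∀ s h : ℝ≥0, IdentDistrib (fun ω => τ (s + h) ω - τ s ω) (τ h) P P
  laplace : ∀ (t : ℝ≥0) (lam : ℝ), 0 < lam →
    ∫ ω, Real.exp (-lam * τ t ω) ∂P = Real.exp (-(t : ℝ) * lam ^ ν)

/-- The inverse (hitting time) process `L_t = inf {x ≥ 0 : τ_x > t}`. -/
def inverseProcess {Ω : Type*} (τ : ℝ≥0 → Ω → ℝ) (t : ℝ) (ω : Ω) : ℝ :=
  ((sInf {x : ℝ≥0 | t < τ x ω} : ℝ≥0) : ℝ)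

/-- The law of `L_t`. -/
def inverseLaw {Ω : Type*} [MeasurableSpace Ω] (τ : ℝ≥0 → Ω → ℝ) (P : Measure Ω) (t : ℝ) :
    Measure ℝ :=
  P.map (inverseProcess τ t)

/-- `ũ^{γ,μ}_ν(x,t) = ∫_0^∞ g̃^γ_μ(x,s) Pr{L_t ∈ ds}`, the composition of `g̃^γ_μ` with the law of
`L_t`. If this law has a density `l(·,t)`, this is `∫_0^∞ g̃^γ_μ(x,s) l(s,t) ds`
(see `uTilde_eq_integral_density`); for `ν = 1` the law is the point mass at `t`. -/
def uTilde {Ω : Type*} [MeasurableSpace Ω] (γ μ : ℝ) (τ : ℝ≥0 → Ω → ℝ) (P : Measure Ω)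
    (x t : ℝ) : ℝ :=
  ∫ s, genGammaTilde γ μ x s ∂(inverseLaw τ P t)

theorem uTilde_eq_integral_density {Ω : Type*} [MeasurableSpace Ω] (γ μ : ℝ)
    (τ : ℝ≥0 → Ω → ℝ) (P : Measure Ω) (x t : ℝ) (l : ℝ → ℝ) (hl : Measurable l)
    (hl0 : ∀ s, 0 ≤ l s)
    (h : inverseLaw τ P t = (volume.restrict (Ioi 0)).withDensity fun s => ENNReal.ofReal (l s)) :
    uTilde γ μ τ P x t = ∫ s in Ioi 0, genGammaTilde γ μ x s * l s := by
  rw [uTilde, h, integral_withDensity_eq_integral_toReal_smul hl.ennreal_ofReal (by simp)]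
  refine integral_congr_ae (Eventually.of_forall fun s => ?_)
  simp [ENNReal.toReal_ofReal (hl0 s), mul_comm]

/-- `f` has at `t > 0` the Dzherbashyan--Caputo derivative `d` of order `ν ∈ (0,1]`:
for `ν < 1`, `f` is differentiable on `(0,t)`, `s ↦ (t-s)^{-ν} f'(s)` is integrable on `(0,t)` and
`d = Γ(1-ν)⁻¹ ∫_0^t (t-s)^{-ν} f'(s) ds`; for `ν = 1`, `d = f'(t)`. -/
def HasCaputoDerivAt (ν : ℝ) (f : ℝ → ℝ) (d t : ℝ) : Prop :=
  (ν < 1 →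
    (∀ s ∈ Ioo 0 t, DifferentiableAt ℝ f s) ∧
    IntervalIntegrable (fun s => (t - s) ^ (-ν) * deriv f s) volume 0 t ∧
    d = (Real.Gamma (1 - ν))⁻¹ * ∫ s in (0 : ℝ)..t, (t - s) ^ (-ν) * deriv f s) ∧
  (ν = 1 → HasDerivAt f d t)

/-- `f` has at `t > 0` the Riemann--Liouville derivative `d` of order `ν ∈ (0,1]`: for `ν < 1`, the
fractional integral `r ↦ Γ(1-ν)⁻¹ ∫_0^r (r-s)^{-ν} f(s) ds` converges for `r` near `t` and has
derivative `d` at `t`; for `ν = 1`, `d = f'(t)`. -/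
def HasRiemannLiouvilleDerivAt (ν : ℝ) (f : ℝ → ℝ) (d t : ℝ) : Prop :=
  (ν < 1 →
    (∀ᶠ r in 𝓝 t, IntervalIntegrable (fun s => (r - s) ^ (-ν) * f s) volume 0 r) ∧
    HasDerivAt (fun r => (Real.Gamma (1 - ν))⁻¹ * ∫ s in (0 : ℝ)..r, (r - s) ^ (-ν) * f s) d t) ∧
  (ν = 1 → HasDerivAt f d t)

end

/-! Everything reduces to one random variable. Self-similarity gives `L_t` the law of `t^ν Z` with
`Z = τ_1^{-ν}` (`IsStableSubordinator.inverseLaw_eq`), and the Laplace transform of `τ_1` gives `Z`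
the moments `n!/Γ(νn+1)` (`IsStableSubordinator.lintegral_pow_eq`). So `ũ(x,t) = E h(t^ν Z)` with `h
= g_μ(x,·)`. Its fractional derivative is `E h'(t^ν Z)` (`IsMittagLefflerLaw.hasFractionalDeriv`).
Since `h'` is the space operator applied to `g_μ`, and that operator passes through the expectation
(`spaceOperator_integral_genGammaTilde_one`), the equation follows.

For `ν = 1`, `Z = 1` almost surely. For `ν < 1`, the substitution `s = tv` turns the Caputo integral
into an average of `E[Z h'(t^ν Z v^ν)]` against `v^(ν-1) (1-v)^(-ν)`. This average is `E h'(t^ν Z)`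
up to the right constant, because size-biasing `Z` and multiplying by `V^ν`, with `V` an independent
Beta(ν, 1-ν) variable, reproduces the law of `Z` (`map_mul_rpow_betaMeasure`): the moments agree,
and their growth is slow enough to determine the law.

The factor `e^{-x/s}` makes `h(s) = O(s)` and `h'` bounded (`exists_bound_genGammaTilde`). Hence `ũ
= O(t^ν)` and its time derivative is `O(t^(ν-1))`, so no boundary term at `0` separates the two
fractional derivatives (`hasDerivAt_integral_sub_rpow_mul`). -/

/-! ### Laws determined by their moments or Laplace transforms. -/

/-- The moments are the derivatives at `0` of the complex moment generating function, which is
analytic there. -/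
theorem complexMGF_id_eventuallyEq_of_moments {m m' : Measure ℝ}
    (h0 : (0 : ℝ) ∈ interior (integrableExpSet id m))
    (h0' : (0 : ℝ) ∈ interior (integrableExpSet id m'))
    (h : ∀ n : ℕ, ∫ x, x ^ n ∂m = ∫ x, x ^ n ∂m') :
    complexMGF id m =ᶠ[𝓝 0] complexMGF id m' := by
  have key : ∀ n : ℕ, iteratedDeriv n (complexMGF id m) 0 =
      iteratedDeriv n (complexMGF id m') 0 := by
    intro n
    rw [iteratedDeriv_complexMGF (by simpa using h0), iteratedDeriv_complexMGF (by simpa using h0')]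
    simp only [id, zero_mul, Complex.exp_zero, mul_one]
    have := congrArg (fun r : ℝ => (r : ℂ)) (h n)
    simp only [← integral_complex_ofReal] at this
    simpa using this
  have a := (analyticAt_complexMGF (X := id) (μ := m) (z := 0) (by simpa using h0)).hasFPowerSeriesAt
  have a' := (analyticAt_complexMGF (X := id) (μ := m') (z := 0)
    (by simpa using h0')).hasFPowerSeriesAt
  simp only [key] at a
  filter_upwards [a.eventually_hasSum, a'.eventually_hasSum] with z hz hz'
  simpa using hz.unique hz'

/-- Finite measures with exponential moments of small order are determined by their moments. -/
theorem ext_of_moments {m m' : Measure ℝ} [IsFiniteMeasure m] [IsFiniteMeasure m']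
    {c : ℝ} (hc : 0 < c)
    (hm : ∀ t, |t| < c → Integrable (fun x => Real.exp (t * x)) m)
    (hm' : ∀ t, |t| < c → Integrable (fun x => Real.exp (t * x)) m')
    (h : ∀ n : ℕ, ∫ x, x ^ n ∂m = ∫ x, x ^ n ∂m') : m = m' := by
  have hs : Ioo (-c) c ⊆ interior (integrableExpSet id m) :=
    interior_maximal (fun t ht => hm t (abs_lt.2 ht)) isOpen_Ioo
  have hs' : Ioo (-c) c ⊆ interior (integrableExpSet id m') :=
    interior_maximal (fun t ht => hm' t (abs_lt.2 ht)) isOpen_Ioo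
  have h0 : (0 : ℝ) ∈ Ioo (-c) c := ⟨by linarith, hc⟩
  have hA : AnalyticOnNhd ℂ (complexMGF id m) {z | z.re ∈ Ioo (-c) c} :=
    analyticOnNhd_complexMGF.mono fun z hz => hs hz
  have hA' : AnalyticOnNhd ℂ (complexMGF id m') {z | z.re ∈ Ioo (-c) c} :=
    analyticOnNhd_complexMGF.mono fun z hz => hs' hz
  -- Identity theorem on the vertical strip, which contains the imaginary axis, where the function
  -- is the characteristic function.
  have heq := hA.eqOn_of_preconnected_of_eventuallyEq hA'
    ((convex_Ioo (-c) c).linear_preimage Complex.reLm).isPreconnected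
    (z₀ := 0) (by simpa using h0) (complexMGF_id_eventuallyEq_of_moments (hs h0) (hs' h0) h)
  refine Measure.ext_of_charFun (funext fun t => ?_)
  rw [← complexMGF_id_mul_I, ← complexMGF_id_mul_I]
  exact heq (by simpa using h0)

/-- Expanding the exponential termwise, the `n!` in the moment bound cancels and a geometric series
of ratio `1/2` remains. -/
theorem lintegral_exp_half_lt_top {m : Measure ℝ} (h0 : ∀ᵐ x ∂m, 0 ≤ x) {K : ℝ}
    (hK : ∀ n : ℕ, ∫⁻ x, ENNReal.ofReal (x ^ n) ∂m ≤ ENNReal.ofReal (K * n.factorial)) :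
    ∫⁻ x, ENNReal.ofReal (Real.exp (x / 2)) ∂m < ⊤ := by
  have e : ∀ᵐ x ∂m, ENNReal.ofReal (Real.exp (x / 2)) =
      ∑' n : ℕ, ENNReal.ofReal ((1 / 2) ^ n / n.factorial) * ENNReal.ofReal (x ^ n) := by
    filter_upwards [h0] with x hx
    rw [Real.exp_eq_exp_ℝ, NormedSpace.exp_eq_tsum_div,
      ENNReal.ofReal_tsum_of_nonneg (fun n => by positivity)
        (NormedSpace.expSeries_div_summable (x / 2))]
    refine tsum_congr fun n => ?_
    rw [← ENNReal.ofReal_mul (by positivity)]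
    congr 1
    rw [div_pow, one_div, inv_pow]
    ring
  rw [lintegral_congr_ae e, lintegral_tsum fun n => by fun_prop]
  have hsum : Summable fun n : ℕ => |K| * (1 / 2 : ℝ) ^ n :=
    (summable_geometric_of_lt_one (by norm_num) (by norm_num)).mul_left _
  refine lt_of_le_of_lt (ENNReal.tsum_le_tsum fun n => ?_)
    (hsum.tsum_ofReal_lt_top)
  rw [lintegral_const_mul _ (by fun_prop)]
  refine (mul_le_mul_right (hK n) _).trans ?_
  rw [← ENNReal.ofReal_mul (by positivity)]
  refine ENNReal.ofReal_le_ofReal ?_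
  have : (0 : ℝ) < n.factorial := by positivity
  calc (1 / 2 : ℝ) ^ n / n.factorial * (K * n.factorial) = K * (1 / 2) ^ n := by field_simp
    _ ≤ _ := by gcongr; exact le_abs_self K

/-- Finite measures on the half-line whose moments grow at most like `n!` are determined by
their moments. -/
theorem ext_of_lintegral_pow {m m' : Measure ℝ} [IsFiniteMeasure m]
    [IsFiniteMeasure m'] (h0 : ∀ᵐ x ∂m, 0 ≤ x) (h0' : ∀ᵐ x ∂m', 0 ≤ x) {K : ℝ}
    (hK : ∀ n : ℕ, ∫⁻ x, ENNReal.ofReal (x ^ n) ∂m ≤ ENNReal.ofReal (K * n.factorial))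
    (h : ∀ n : ℕ, ∫⁻ x, ENNReal.ofReal (x ^ n) ∂m = ∫⁻ x, ENNReal.ofReal (x ^ n) ∂m') :
    m = m' := by
  have aux : ∀ m : Measure ℝ, (∀ᵐ x ∂m, 0 ≤ x) →
      (∀ n : ℕ, ∫⁻ x, ENNReal.ofReal (x ^ n) ∂m ≤ ENNReal.ofReal (K * n.factorial)) →
      ∀ t : ℝ, |t| < 1 / 2 → Integrable (fun x => Real.exp (t * x)) m := by
    intro m h0 hK t ht
    have hi : Integrable (fun x => Real.exp (x / 2)) m :=
      ⟨by fun_prop, by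
        rw [hasFiniteIntegral_iff_ofReal (ae_of_all _ fun x => (Real.exp_pos _).le)]
        exact lintegral_exp_half_lt_top h0 hK⟩
    refine hi.mono' (by fun_prop) ?_
    filter_upwards [h0] with x hx
    rw [Real.norm_eq_abs, abs_of_pos (Real.exp_pos _)]
    refine Real.exp_le_exp.2 ?_
    nlinarith [(abs_lt.1 ht).2]
  refine ext_of_moments (c := 1 / 2) (by norm_num) (aux m h0 hK)
    (aux m' h0' fun n => (h n).symm.trans_le (hK n)) fun n => ?_
  rw [integral_eq_lintegral_of_nonneg_ae, integral_eq_lintegral_of_nonneg_ae, h n]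
  · filter_upwards [h0'] with x hx using pow_nonneg hx n
  · fun_prop
  · filter_upwards [h0] with x hx using pow_nonneg hx n
  · fun_prop

theorem integrable_exp_neg_mul {Ω : Type*} [MeasurableSpace Ω] {P : Measure Ω} [IsFiniteMeasure P]
    {T : Ω → ℝ} (hT : Measurable T) (h0 : ∀ᵐ ω ∂P, 0 ≤ T ω) {a : ℝ} (ha : 0 ≤ a) :
    Integrable (fun ω => Real.exp (-a * T ω)) P := by
  refine Integrable.mono' (integrable_const 1) (by fun_prop) ?_
  filter_upwards [h0] with ω hω
  rw [Real.norm_eq_abs, abs_of_pos (Real.exp_pos _), Real.exp_le_one_iff]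
  nlinarith

/-- Laplace transforms determine laws on the half-line. -/
theorem map_eq_of_laplace {Ω : Type*} [MeasurableSpace Ω] {P : Measure Ω} [IsProbabilityMeasure P]
    {T S : Ω → ℝ} (hT : Measurable T) (hS : Measurable S) (hT0 : ∀ᵐ ω ∂P, 0 ≤ T ω)
    (hS0 : ∀ᵐ ω ∂P, 0 ≤ S ω)
    (h : ∀ a : ℝ, 0 < a → ∫ ω, Real.exp (-a * T ω) ∂P = ∫ ω, Real.exp (-a * S ω) ∂P) :
    P.map T = P.map S := by
  -- The variable `e^{-U}` has as `n`-th moment the Laplace transform of `U` at `n`, and `-log`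
  -- recovers `U`.
  have aux : ∀ U : Ω → ℝ, Measurable U → P.map U =
      (P.map fun ω => Real.exp (-U ω)).map fun x => -Real.log x := by
    intro U hU
    rw [Measure.map_map (by fun_prop) (by fun_prop)]
    congr 1
    funext ω
    simp
  have hl : ∀ U : Ω → ℝ, Measurable U → (∀ᵐ ω ∂P, 0 ≤ U ω) → ∀ n : ℕ,
      ∫⁻ x, ENNReal.ofReal (x ^ n) ∂(P.map fun ω => Real.exp (-U ω)) =
        ENNReal.ofReal (∫ ω, Real.exp (-(n : ℝ) * U ω) ∂P) := by
    intro U hU hU0 n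
    rw [lintegral_map (by fun_prop) (by fun_prop), ofReal_integral_eq_lintegral_ofReal
      (integrable_exp_neg_mul hU hU0 n.cast_nonneg) (ae_of_all _ fun ω => (Real.exp_pos _).le)]
    refine lintegral_congr fun ω => ?_
    rw [← Real.exp_nat_mul]
    ring_nf
  have hpos : ∀ U : Ω → ℝ, Measurable U →
      ∀ᵐ x ∂(P.map fun ω => Real.exp (-U ω)), 0 ≤ x := by
    intro U hU
    rw [ae_map_iff (by fun_prop) measurableSet_Ici]
    exact ae_of_all _ fun ω => (Real.exp_pos _).le
  rw [aux T hT, aux S hS]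
  have i1 : IsProbabilityMeasure (P.map fun ω => Real.exp (-T ω)) :=
    Measure.isProbabilityMeasure_map (by fun_prop)
  have i2 : IsProbabilityMeasure (P.map fun ω => Real.exp (-S ω)) :=
    Measure.isProbabilityMeasure_map (by fun_prop)
  congr 1
  refine ext_of_lintegral_pow (K := 1) (hpos T hT) (hpos S hS) (fun n => ?_) fun n => ?_
  · rw [hl T hT hT0]
    refine ENNReal.ofReal_le_ofReal ?_
    calc ∫ ω, Real.exp (-(n : ℝ) * T ω) ∂P ≤ ∫ _, (1 : ℝ) ∂P := by
          refine integral_mono_ae (integrable_exp_neg_mul hT hT0 n.cast_nonneg)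
            (integrable_const 1) ?_
          filter_upwards [hT0] with ω hω
          rw [Real.exp_le_one_iff]
          nlinarith [n.cast_nonneg (α := ℝ)]
      _ ≤ 1 * (n.factorial : ℝ) := by
          have : (1 : ℝ) ≤ n.factorial := by exact_mod_cast n.factorial_pos
          simpa using this
  · rw [hl T hT hT0, hl S hS hS0]
    -- The hypothesis covers only `a > 0`; the moment of order `0` is the total mass.
    rcases Nat.eq_zero_or_pos n with rfl | hn
    · simp
    · rw [h n (by exact_mod_cast hn)]

/-! ### Marginals of the subordinator and the law of its inverse. -/

namespace IsStableSubordinator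

variable {Ω : Type*} [MeasurableSpace Ω] {P : Measure Ω} {ν : ℝ} {τ : ℝ≥0 → Ω → ℝ}

theorem ae_nonneg (hτ : IsStableSubordinator ν τ P) : ∀ᵐ ω ∂P, ∀ y, 0 ≤ τ y ω := by
  filter_upwards [hτ.start_zero, hτ.monotone] with ω h0 hm y
  simpa [h0] using hm (zero_le (a := y))

variable [IsProbabilityMeasure P]

/-- Chernoff bound for the lower tail. Letting `a → ∞` at `t = 0` gives positivity of `τ_1`; fixing
`a = 1` and letting `y → ∞` gives unboundedness of the paths. -/
theorem measure_le_le (hτ : IsStableSubordinator ν τ P) (y : ℝ≥0) (t : ℝ) {a : ℝ} (ha : 0 < a) :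
    P.real {ω | τ y ω ≤ t} ≤ Real.exp (a * t) * Real.exp (-(y : ℝ) * a ^ ν) := by
  have h := measure_le_le_exp_mul_mgf (X := τ y) (μ := P) (t := -a) t (by linarith)
    (integrable_exp_neg_mul (hτ.measurable y) (hτ.ae_nonneg.mono fun ω h => h y) ha.le)
  rwa [mgf, hτ.laplace y a ha, neg_neg] at h

theorem ae_pos (hν : 0 < ν) (hτ : IsStableSubordinator ν τ P) : ∀ᵐ ω ∂P, 0 < τ 1 ω := by
  have h : P.real {ω | τ 1 ω ≤ 0} ≤ 0 := by
    have hl : Tendsto (fun a : ℝ => Real.exp (-(a ^ ν))) atTop (𝓝 0) :=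
      Real.tendsto_exp_neg_atTop_nhds_zero.comp (tendsto_rpow_atTop hν)
    refine ge_of_tendsto hl ?_
    filter_upwards [eventually_gt_atTop 0] with a ha
    simpa using hτ.measure_le_le 1 0 ha
  have h' : P {ω | τ 1 ω ≤ 0} = 0 := by
    rw [← measureReal_eq_zero_iff]; exact le_antisymm h measureReal_nonneg
  rw [ae_iff]
  simpa using h'

/-- This rules out the empty set in the infimum defining `L_t`, where `sInf ∅ = 0` would be a
spurious value. -/
theorem ae_exists_gt (hτ : IsStableSubordinator ν τ P) (t : ℝ) : ∀ᵐ ω ∂P, ∃ y, t < τ y ω := by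
  have h : P.real {ω | ∀ y, τ y ω ≤ t} ≤ 0 := by
    have hl : Tendsto (fun n : ℕ => Real.exp t * Real.exp (-(n : ℝ))) atTop
        (𝓝 (Real.exp t * 0)) :=
      (Real.tendsto_exp_neg_atTop_nhds_zero.comp tendsto_natCast_atTop_atTop).const_mul _
    rw [mul_zero] at hl
    refine ge_of_tendsto' hl fun n => ?_
    have hsub : {ω | ∀ y, τ y ω ≤ t} ⊆ {ω | τ (n : ℝ≥0) ω ≤ t} := fun ω hω => hω _
    refine (measureReal_mono hsub).trans ?_
    simpa using hτ.measure_le_le n t one_pos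
  have h' : P {ω | ∀ y, τ y ω ≤ t} = 0 := by
    rw [← measureReal_eq_zero_iff]; exact le_antisymm h measureReal_nonneg
  rw [ae_iff]
  simpa using h'

/-- Self-similarity of the one-dimensional marginals. -/
theorem map_eq_map_one (hν : 0 < ν) (hτ : IsStableSubordinator ν τ P) {y : ℝ≥0} :
    P.map (τ y) = P.map fun ω => (y : ℝ) ^ (1 / ν) * τ 1 ω := by
  have hy : 0 ≤ (y : ℝ) ^ (1 / ν) := by positivity
  refine map_eq_of_laplace (hτ.measurable y) ((hτ.measurable 1).const_mul _)
    (hτ.ae_nonneg.mono fun ω h => h y) (hτ.ae_nonneg.mono fun ω h => mul_nonneg hy (h 1))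
    fun a ha => ?_
  rw [hτ.laplace y a ha]
  rcases eq_or_ne y 0 with rfl | hy0
  · simp [hν.ne']
  have hy' : 0 < (y : ℝ) := by positivity
  have := hτ.laplace 1 (a * (y : ℝ) ^ (1 / ν)) (by positivity)
  simp only [← mul_assoc, ← neg_mul] at this ⊢
  rw [this, Real.mul_rpow ha.le hy, ← Real.rpow_mul hy'.le, one_div_mul_cancel hν.ne', Real.rpow_one]
  simp [mul_comm]

theorem measure_le_eq (hν : 0 < ν) (hτ : IsStableSubordinator ν τ P) {y : ℝ≥0} (hy : 0 < y)
    {t : ℝ} (ht : 0 < t) :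
    P {ω | τ y ω ≤ t} = P {ω | (y : ℝ) ≤ t ^ ν * τ 1 ω ^ (-ν)} := by
  have h1 := congrArg (fun m => m (Iic t)) (hτ.map_eq_map_one hν (y := y))
  simp only [Measure.map_apply (hτ.measurable y) measurableSet_Iic,
    Measure.map_apply ((hτ.measurable 1).const_mul _) measurableSet_Iic] at h1
  refine h1.trans (measure_congr ?_)
  filter_upwards [hτ.ae_pos hν] with ω hω
  have hy' : 0 < (y : ℝ) := hy
  refine propext ?_
  change (y : ℝ) ^ (1 / ν) * τ 1 ω ≤ t ↔ (y : ℝ) ≤ t ^ ν * τ 1 ω ^ (-ν)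
  rw [Real.rpow_neg hω.le, ← div_eq_mul_inv, ← Real.div_rpow ht.le hω.le, ← le_div_iff₀ hω,
    one_div]
  exact Real.rpow_inv_le_iff_of_pos hy'.le (by positivity) hν

/-- On a monotone path that passes level `t`, the infimum exceeds `y` exactly when some point
strictly to the right of `y` has not passed that level. The sequence `1/(n+1)` keeps the union
countable. -/
theorem setOf_lt_inverseProcess_ae (hτ : IsStableSubordinator ν τ P) (t : ℝ) :
    ∀ᵐ ω ∂P, ∀ y : ℝ≥0, (y : ℝ) < inverseProcess τ t ω ↔
      ∃ n : ℕ, τ (y + 1 / ((n : ℝ≥0) + 1)) ω ≤ t := by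
  filter_upwards [hτ.monotone, hτ.ae_exists_gt t] with ω hm hne y
  rw [inverseProcess, NNReal.coe_lt_coe]
  constructor
  · intro h
    obtain ⟨n, hn⟩ := exists_nat_one_div_lt (tsub_pos_of_lt h)
    refine ⟨n, not_lt.1 fun hlt => ?_⟩
    have h1 : sInf {x : ℝ≥0 | t < τ x ω} ≤ y + 1 / ((n : ℝ≥0) + 1) :=
      csInf_le (OrderBot.bddBelow _) hlt
    exact absurd h1 (not_le.2 (lt_tsub_iff_left.1 hn))
  · rintro ⟨n, hn⟩
    have h1 : y + 1 / ((n : ℝ≥0) + 1) ≤ sInf {x : ℝ≥0 | t < τ x ω} := by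
      refine le_csInf hne fun x hx => not_lt.1 fun hlt => ?_
      exact absurd (hm hlt.le) (not_le.2 (lt_of_le_of_lt hn hx))
    exact lt_of_lt_of_le (lt_add_of_pos_right _ (by positivity)) h1

theorem aemeasurable_inverseProcess (hτ : IsStableSubordinator ν τ P) (t : ℝ) :
    AEMeasurable (inverseProcess τ t) P := by
  refine NullMeasurable.aemeasurable (f := inverseProcess τ t) (μ := P) ?_
  refine measurable_of_Ioi (δ := NullMeasurableSpace Ω P) fun y => ?_
  change NullMeasurableSet (inverseProcess τ t ⁻¹' Ioi y) P
  rcases lt_or_ge y 0 with hy | hy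
  · have : inverseProcess τ t ⁻¹' Ioi y = univ :=
      eq_univ_of_forall fun ω => hy.trans_le (NNReal.coe_nonneg _)
    rw [this]
    exact nullMeasurableSet_univ
  lift y to ℝ≥0 using hy
  have hm : MeasurableSet {ω | ∃ n : ℕ, τ (y + 1 / ((n : ℝ≥0) + 1)) ω ≤ t} := by
    rw [ofPred_exists]
    exact MeasurableSet.iUnion fun n => measurableSet_le (hτ.measurable _) measurable_const
  refine hm.nullMeasurableSet.congr ?_
  filter_upwards [hτ.setOf_lt_inverseProcess_ae t] with ω hω
  exact propext (hω y).symm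

/-- Both events are increasing unions along `w n ↓ y`, and the events in the unions have equal
probabilities by self-similarity. -/
theorem measure_lt_inverseProcess (hν : 0 < ν) (hτ : IsStableSubordinator ν τ P) {t : ℝ}
    (ht : 0 < t) (y : ℝ≥0) :
    P {ω | (y : ℝ) < inverseProcess τ t ω} = P {ω | (y : ℝ) < t ^ ν * τ 1 ω ^ (-ν)} := by
  set w : ℕ → ℝ≥0 := fun n => y + 1 / ((n : ℝ≥0) + 1) with hw
  have hwanti : Antitone w := fun a b hab => by
    simp only [hw]
    gcongr
  have hwpos : ∀ n, 0 < w n := fun n => by positivity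
  -- The events `τ (w n) ≤ t` increase with `n` only on monotone paths; intersecting with this
  -- full-measure set makes continuity from below applicable.
  set G : Set Ω := {ω | Monotone fun s => τ s ω} with hG
  have h1 : P {ω | (y : ℝ) < inverseProcess τ t ω} = P (⋃ n, {ω | τ (w n) ω ≤ t} ∩ G) := by
    refine measure_congr ?_
    filter_upwards [hτ.setOf_lt_inverseProcess_ae t, hτ.monotone] with ω hω hm
    refine propext ((hω y).trans ?_)
    change _ ↔ ω ∈ ⋃ n, {ω | τ (w n) ω ≤ t} ∩ G
    rw [mem_iUnion]
    exact exists_congr fun n => ⟨fun h => ⟨h, hm⟩, fun h => h.1⟩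
  have h2 : {ω | (y : ℝ) < t ^ ν * τ 1 ω ^ (-ν)} =
      ⋃ n, {ω | (w n : ℝ) ≤ t ^ ν * τ 1 ω ^ (-ν)} := by
    ext ω
    rw [mem_iUnion]
    change (y : ℝ) < t ^ ν * τ 1 ω ^ (-ν) ↔ ∃ n, (w n : ℝ) ≤ t ^ ν * τ 1 ω ^ (-ν)
    constructor
    · intro h
      obtain ⟨n, hn⟩ := exists_nat_one_div_lt (sub_pos.2 h)
      refine ⟨n, ?_⟩
      simp only [hw]
      push_cast
      linarith
    · rintro ⟨n, hn⟩
      refine lt_of_lt_of_le ?_ hn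
      exact NNReal.coe_lt_coe.2 (lt_add_of_pos_right y (by positivity))
  rw [h1, h2, Monotone.measure_iUnion, Monotone.measure_iUnion]
  · refine iSup_congr fun n => ?_
    rw [← hτ.measure_le_eq hν (hwpos n) ht]
    rw [inter_comm]
    exact Measure.measure_inter_eq_of_ae (t := G) hτ.monotone
  · intro a b hab ω h
    exact le_trans (NNReal.coe_le_coe.2 (hwanti hab)) h
  · intro a b hab ω h
    exact ⟨(h.2 (hwanti hab)).trans h.1, h.2⟩

theorem inverseLaw_eq (hν : 0 < ν) (hτ : IsStableSubordinator ν τ P) {t : ℝ} (ht : 0 < t) :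
    inverseLaw τ P t = (P.map fun ω => τ 1 ω ^ (-ν)).map fun z => t ^ ν * z := by
  have hm := hτ.measurable 1
  have hL := hτ.aemeasurable_inverseProcess t
  have hm' : Measurable fun ω => t ^ ν * τ 1 ω ^ (-ν) := by fun_prop
  rw [Measure.map_map (by fun_prop) (by fun_prop), inverseLaw]
  change _ = P.map fun ω => t ^ ν * τ 1 ω ^ (-ν)
  have i1 := Measure.isProbabilityMeasure_map hL
  have i2 := Measure.isProbabilityMeasure_map (μ := P) hm'.aemeasurable
  refine Measure.ext_of_Iic _ _ fun y => ?_
  rw [← compl_Ioi, prob_compl_eq_one_sub measurableSet_Ioi, prob_compl_eq_one_sub measurableSet_Ioi,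
    Measure.map_apply_of_aemeasurable hL measurableSet_Ioi, Measure.map_apply hm' measurableSet_Ioi]
  congr 1
  rcases lt_or_ge y 0 with hy | hy
  · refine measure_congr ?_
    filter_upwards [hτ.ae_pos hν] with ω hω
    refine propext (iff_of_true ?_ ?_)
    · exact hy.trans_le (NNReal.coe_nonneg _)
    · exact hy.trans (by positivity)
  · lift y to ℝ≥0 using hy
    exact hτ.measure_lt_inverseProcess hν ht y

/-- The moments of `τ_1 ^ (-ν)`. -/
theorem lintegral_pow_eq (hν : 0 < ν) (hτ : IsStableSubordinator ν τ P) (n : ℕ) :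
    ∫⁻ z, ENNReal.ofReal (z ^ n) ∂(P.map fun ω => τ 1 ω ^ (-ν)) =
      ENNReal.ofReal (n.factorial / Real.Gamma (ν * n + 1)) := by
  have hm := hτ.measurable 1
  rw [lintegral_map (by fun_prop) (by fun_prop)]
  -- The Gamma integral below needs exponent `νn > 0`.
  rcases Nat.eq_zero_or_pos n with rfl | hn
  · simp
  have hn' : (0 : ℝ) < n := by exact_mod_cast hn
  have hνn : 0 < ν * n := by positivity
  have hΓ := Real.Gamma_pos_of_pos hνn
  -- Negative powers as Gamma integrals: `τ^(-νn) = Γ(νn)⁻¹ ∫ a^(νn-1) e^{-aτ} da`. After Tonelli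
  -- the Laplace transform replaces `e^{-aτ}` by `e^{-a^ν}`, and the remaining integral is `Γ(n)/ν`.
  have e1 : ∀ᵐ ω ∂P, ENNReal.ofReal ((τ 1 ω ^ (-ν)) ^ n) =
      ENNReal.ofReal (Real.Gamma (ν * n))⁻¹ *
        ∫⁻ a in Ioi (0 : ℝ), ENNReal.ofReal (a ^ (ν * n - 1) * Real.exp (-a * τ 1 ω)) := by
    filter_upwards [hτ.ae_pos hν] with ω hω
    have h := Real.integral_rpow_mul_exp_neg_mul_Ioi hνn hω
    have hi : Integrable (fun a : ℝ => a ^ (ν * n - 1) * Real.exp (-a * τ 1 ω))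
        (volume.restrict (Ioi 0)) := by
      -- A nonintegrable function has Bochner integral `0`, so a positive value already proves
      -- integrability.
      refine Integrable.of_integral_ne_zero (ne_of_gt ?_)
      have : ∀ a, -a * τ 1 ω = -(τ 1 ω * a) := fun a => by ring
      simp only [this, h]
      positivity
    rw [← ofReal_integral_eq_lintegral_ofReal hi, ← ENNReal.ofReal_mul (by positivity)]
    · congr 1
      have : ∀ a, -a * τ 1 ω = -(τ 1 ω * a) := fun a => by ring
      simp only [this, h]
      rw [one_div, Real.inv_rpow hω.le, ← Real.rpow_neg hω.le, ← Real.rpow_natCast,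
        ← Real.rpow_mul hω.le, ← neg_mul]
      field_simp
    · filter_upwards [ae_restrict_mem measurableSet_Ioi] with a ha
      have : (0 : ℝ) < a := ha
      change 0 ≤ a ^ (ν * n - 1) * Real.exp (-a * τ 1 ω)
      positivity
  rw [lintegral_congr_ae e1, lintegral_const_mul _ (by fun_prop),
    lintegral_lintegral_swap (by fun_prop)]
  have e2 : ∀ a ∈ Ioi (0 : ℝ), ∫⁻ ω, ENNReal.ofReal (a ^ (ν * n - 1) * Real.exp (-a * τ 1 ω)) ∂P =
      ENNReal.ofReal (a ^ (ν * n - 1) * Real.exp (-a ^ ν)) := by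
    intro a ha
    have ha' : (0 : ℝ) < a := ha
    rw [← ofReal_integral_eq_lintegral_ofReal, integral_const_mul, hτ.laplace 1 a ha]
    · simp
    · exact (integrable_exp_neg_mul hm (hτ.ae_nonneg.mono fun ω h => h 1) ha'.le).const_mul _
    · exact ae_of_all _ fun ω => by positivity
  rw [setLIntegral_congr_fun measurableSet_Ioi e2]
  have h := integral_rpow_mul_exp_neg_rpow (p := ν) (q := ν * n - 1) hν (by linarith)
  have hdiv : (ν * n - 1 + 1) / ν = n := by field_simp; ring
  rw [hdiv] at h
  have hΓn := Real.Gamma_pos_of_pos hn'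
  rw [← ofReal_integral_eq_lintegral_ofReal, h, ← ENNReal.ofReal_mul (by positivity)]
  · congr 1
    rw [Real.Gamma_add_one hνn.ne']
    obtain ⟨k, rfl⟩ : ∃ k, n = k + 1 := ⟨n - 1, by omega⟩
    rw [Nat.factorial_succ]
    push_cast
    rw [Real.Gamma_nat_eq_factorial]
    push_cast at hn' hνn hΓ
    field_simp
  · refine Integrable.of_integral_ne_zero (ne_of_gt ?_)
    rw [h]
    positivity
  · filter_upwards [ae_restrict_mem measurableSet_Ioi] with a ha
    have : (0 : ℝ) < a := ha
    change 0 ≤ a ^ (ν * n - 1) * Real.exp (-a ^ ν)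
    positivity

end IsStableSubordinator

/-! ### Beta laws and the Mittag-Leffler law. -/

/-- `Γ ≥ 1` on `[2, ∞)` by monotonicity, and on `[1, 2)` the functional equation gives `Γ(y) =
Γ(y+1)/y ≥ 1/y`. -/
theorem half_le_Gamma {y : ℝ} (hy : 1 ≤ y) : 1 / 2 ≤ Real.Gamma y := by
  have h2 : ∀ x : ℝ, 2 ≤ x → 1 ≤ Real.Gamma x := fun x hx => by
    have := Real.Gamma_strictMonoOn_Ici.monotoneOn (show (2 : ℝ) ∈ Ici 2 by simp) hx hx
    rwa [Real.Gamma_two] at this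
  rcases le_or_gt 2 y with h | h
  · linarith [h2 y h]
  · have h3 := h2 (y + 1) (by linarith)
    rw [Real.Gamma_add_one (by linarith)] at h3
    nlinarith [Real.Gamma_pos_of_pos (show 0 < y by linarith)]

/-- Multiplying the Beta(a, b) density by `v^p` yields a multiple of the Beta(a+p, b) density. -/
theorem lintegral_rpow_betaMeasure {a b p : ℝ} (ha : 0 < a) (hb : 0 < b) (hp : 0 ≤ p) :
    ∫⁻ v, ENNReal.ofReal (v ^ p) ∂(betaMeasure a b) = ENNReal.ofReal (beta (a + p) b / beta a b) := by
  have hB := beta_pos ha hb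
  have hB' := beta_pos (show 0 < a + p by linarith) hb
  have e : ∀ v, betaPDF a b v * ENNReal.ofReal (v ^ p) =
      ENNReal.ofReal (beta (a + p) b / beta a b) * betaPDF (a + p) b v := by
    intro v
    rcases le_or_gt v 0 with hv | hv
    · simp [betaPDF_eq_zero_of_nonpos hv]
    rcases le_or_gt 1 v with hv1 | hv1
    · simp [betaPDF_eq_zero_of_one_le hv1]
    have hv1' : 0 < 1 - v := by linarith
    rw [betaPDF_of_pos_lt_one hv hv1, betaPDF_of_pos_lt_one hv hv1,
      ← ENNReal.ofReal_mul (by positivity), ← ENNReal.ofReal_mul (by positivity)]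
    congr 1
    rw [show a + p - 1 = (a - 1) + p by ring, Real.rpow_add hv]
    field_simp
  have hme : Measurable (betaPDF a b) := (measurable_betaPDFReal a b).ennreal_ofReal
  have hme' : Measurable (betaPDF (a + p) b) := (measurable_betaPDFReal (a + p) b).ennreal_ofReal
  rw [betaMeasure, lintegral_withDensity_eq_lintegral_mul _ hme (by fun_prop)]
  simp only [Pi.mul_apply, e]
  rw [lintegral_const_mul _ hme', lintegral_betaPDF_eq_one (by linarith) hb, mul_one]

theorem ae_betaMeasure_mem_Ioo (a b : ℝ) : ∀ᵐ v ∂(betaMeasure a b), v ∈ Ioo (0 : ℝ) 1 := by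
  have hme : Measurable (betaPDF a b) := (measurable_betaPDFReal a b).ennreal_ofReal
  rw [betaMeasure, ae_withDensity_iff hme]
  refine ae_of_all _ fun v hv => ⟨not_le.1 fun h => hv (betaPDF_eq_zero_of_nonpos h),
    not_le.1 fun h => hv (betaPDF_eq_zero_of_one_le h)⟩

theorem integral_betaMeasure {a b : ℝ} (ha : 0 < a) (hb : 0 < b) (f : ℝ → ℝ) :
    ∫ v, f v ∂(betaMeasure a b) =
      (beta a b)⁻¹ * ∫ v in (0 : ℝ)..1, v ^ (a - 1) * (1 - v) ^ (b - 1) * f v := by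
  have hme : Measurable (betaPDF a b) := (measurable_betaPDFReal a b).ennreal_ofReal
  rw [betaMeasure, integral_withDensity_eq_integral_toReal_smul hme
    (ae_of_all _ fun v => ENNReal.ofReal_lt_top),
    ← intervalIntegral.integral_const_mul, intervalIntegral.integral_of_le zero_le_one, integral_Ioc_eq_integral_Ioo,
    ← integral_indicator measurableSet_Ioo]
  refine integral_congr_ae (ae_of_all _ fun v => ?_)
  by_cases hv : v ∈ Ioo (0 : ℝ) 1
  · have hB := beta_pos ha hb
    have h1 : 0 < v := hv.1
    have h2 : 0 < 1 - v := by linarith [hv.2]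
    simp only [indicator_of_mem hv, smul_eq_mul]
    rw [betaPDF_of_pos_lt_one hv.1 hv.2, ENNReal.toReal_ofReal (by positivity)]
    ring
  · simp only [indicator_of_notMem hv, smul_eq_mul]
    rw [mem_Ioo, not_and_or, not_lt, not_lt] at hv
    rcases hv with h | h
    · simp [betaPDF_eq_zero_of_nonpos h]
    · simp [betaPDF_eq_zero_of_one_le h]

/-- `m` is the Mittag-Leffler law of order `ν`: it lives on the positive half-line and its `n`-th
moment is `n! / Γ(νn + 1)`. -/
structure IsMittagLefflerLaw (ν : ℝ) (m : Measure ℝ) : Prop where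
  ae_pos : ∀ᵐ z ∂m, 0 < z
  lintegral_pow : ∀ n : ℕ, ∫⁻ z, ENNReal.ofReal (z ^ n) ∂m =
    ENNReal.ofReal (n.factorial / Real.Gamma (ν * n + 1))

namespace IsMittagLefflerLaw

variable {ν : ℝ} {m : Measure ℝ}

theorem isProbabilityMeasure (hm : IsMittagLefflerLaw ν m) : IsProbabilityMeasure m :=
  ⟨by simpa using hm.lintegral_pow 0⟩

theorem integrable_pow (hm : IsMittagLefflerLaw ν m) (n : ℕ) : Integrable (fun z => z ^ n) m :=
  ⟨by fun_prop, by
    rw [hasFiniteIntegral_iff_ofReal (hm.ae_pos.mono fun z hz => pow_nonneg hz.le n),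
      hm.lintegral_pow]
    exact ENNReal.ofReal_lt_top⟩

theorem integral_pow (hν : 0 < ν) (hm : IsMittagLefflerLaw ν m) (n : ℕ) :
    ∫ z, z ^ n ∂m = n.factorial / Real.Gamma (ν * n + 1) := by
  have hΓ := Real.Gamma_pos_of_pos (show 0 < ν * n + 1 by positivity)
  rw [integral_eq_lintegral_of_nonneg_ae (hm.ae_pos.mono fun z hz => pow_nonneg hz.le n)
    (by fun_prop), hm.lintegral_pow, ENNReal.toReal_ofReal (by positivity)]

theorem integrable_id (hm : IsMittagLefflerLaw ν m) : Integrable (fun z => z) m := by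
  simpa using hm.integrable_pow 1

/-- The law of order `1` is the point mass at `1`. -/
theorem ae_eq_one (hm : IsMittagLefflerLaw 1 m) : ∀ᵐ z ∂m, z = 1 := by
  have := hm.isProbabilityMeasure
  have h1 := hm.integral_pow one_pos 1
  have h2 := hm.integral_pow one_pos 2
  have i1 := hm.integrable_pow 1
  have i2 := hm.integrable_pow 2
  have g2 : Real.Gamma (1 * ((2 : ℕ) : ℝ) + 1) = 2 := by
    rw [one_mul, Real.Gamma_nat_eq_factorial]; norm_num
  have g1 : Real.Gamma (1 * ((1 : ℕ) : ℝ) + 1) = 1 := by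
    rw [one_mul, Real.Gamma_nat_eq_factorial]; norm_num
  rw [g1] at h1
  rw [g2] at h2
  have e : ∀ z : ℝ, (z - 1) ^ 2 = z ^ 2 - 2 * z ^ 1 + 1 := fun z => by ring
  -- The first two moments are `1!/Γ(2) = 1` and `2!/Γ(3) = 1`, so the variance vanishes.
  have h : ∫ z, (z - 1) ^ 2 ∂m = 0 := by
    simp only [e]
    have h3 : ∫ z, (z ^ 2 - 2 * z ^ 1) ∂m = -1 := by
      rw [integral_sub i2 (i1.const_mul 2), integral_const_mul, h1, h2]
      norm_num [Nat.factorial]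
    have h4 := integral_add (i2.sub (i1.const_mul 2)) (integrable_const (1 : ℝ))
    simp only [Pi.sub_apply] at h4
    rw [h4, h3]
    simp
  have hi : Integrable (fun z : ℝ => (z - 1) ^ 2) m := by
    simp only [e]
    exact (i2.sub (i1.const_mul 2)).add (integrable_const 1)
  filter_upwards [(integral_eq_zero_iff_of_nonneg (fun z => sq_nonneg (z - 1)) hi).1 h] with z hz
  have : (z - 1) ^ 2 = 0 := hz
  linarith [pow_eq_zero_iff two_ne_zero |>.1 this]

/-- If `Z` has the Mittag-Leffler law of order `ν < 1`, so does `Z V ^ ν`, where `V` has the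
`Beta(ν, 1 - ν)` law and is independent of `Z`, under the law weighted by `Γ(1 + ν) Z`. -/
theorem map_mul_rpow_betaMeasure (hν : 0 < ν) (hν1 : ν < 1) (hm : IsMittagLefflerLaw ν m) :
    ENNReal.ofReal (Real.Gamma (1 + ν)) •
      (((m.withDensity fun z => ENNReal.ofReal z).prod (betaMeasure ν (1 - ν))).map
        fun p : ℝ × ℝ => p.1 * p.2 ^ ν) = m := by
  have := hm.isProbabilityMeasure
  have hν1' : 0 < 1 - ν := by linarith
  have i1 := isProbabilityMeasureBeta hν hν1'
  have i2 : IsFiniteMeasure (m.withDensity fun z => ENNReal.ofReal z) :=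
    isFiniteMeasure_withDensity_ofReal hm.integrable_id.2
  have hmeas : Measurable fun p : ℝ × ℝ => p.1 * p.2 ^ ν := by fun_prop
  have i3 : IsFiniteMeasure (ENNReal.ofReal (Real.Gamma (1 + ν)) •
      (((m.withDensity fun z => ENNReal.ofReal z).prod (betaMeasure ν (1 - ν))).map
        fun p : ℝ × ℝ => p.1 * p.2 ^ ν)) :=
    Measure.smul_finite _ ENNReal.ofReal_ne_top
  have hpos : ∀ᵐ z ∂(m.withDensity fun z => ENNReal.ofReal z), 0 < z :=
    (withDensity_absolutelyContinuous _ _).ae_le hm.ae_pos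
  have hpos2 : ∀ᵐ p : ℝ × ℝ ∂((m.withDensity fun z => ENNReal.ofReal z).prod
      (betaMeasure ν (1 - ν))), 0 < p.1 ∧ p.2 ∈ Ioo (0 : ℝ) 1 :=
    (Measure.quasiMeasurePreserving_fst.ae hpos).and
      (Measure.quasiMeasurePreserving_snd.ae (ae_betaMeasure_mem_Ioo ν (1 - ν)))
  -- `K = 2` because `Γ(νn+1) ≥ 1/2`.
  refine (ext_of_lintegral_pow (K := 2) (hm.ae_pos.mono fun z hz => hz.le) ?_ (fun n => ?_)
    fun n => ?_).symm
  · refine Measure.ae_smul_measure ?_ _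
    rw [ae_map_iff hmeas.aemeasurable measurableSet_Ici]
    filter_upwards [hpos2] with p hp
    exact mul_nonneg hp.1.le (Real.rpow_nonneg hp.2.1.le _)
  · rw [hm.lintegral_pow]
    refine ENNReal.ofReal_le_ofReal ?_
    have hΓ := half_le_Gamma (show 1 ≤ ν * n + 1 by
      have : 0 ≤ ν * n := by positivity
      linarith)
    rw [div_le_iff₀ (by linarith)]
    have : (0 : ℝ) < n.factorial := by positivity
    nlinarith
  · have e : ∀ᵐ p : ℝ × ℝ ∂((m.withDensity fun z => ENNReal.ofReal z).prod
        (betaMeasure ν (1 - ν))), ENNReal.ofReal ((p.1 * p.2 ^ ν) ^ n) =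
          ENNReal.ofReal (p.1 ^ n) * ENNReal.ofReal (p.2 ^ (ν * n)) := by
      filter_upwards [hpos2] with p hp
      rw [mul_pow, ENNReal.ofReal_mul (pow_nonneg hp.1.le n), ← Real.rpow_natCast (p.2 ^ ν),
        ← Real.rpow_mul hp.2.1.le]
    rw [lintegral_smul_measure, lintegral_map (by fun_prop) hmeas, lintegral_congr_ae e,
      lintegral_prod_mul (f := fun z : ℝ => ENNReal.ofReal (z ^ n))
        (g := fun v : ℝ => ENNReal.ofReal (v ^ (ν * n))) (by fun_prop) (by fun_prop),
      lintegral_rpow_betaMeasure hν hν1' (by positivity),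
      lintegral_withDensity_eq_lintegral_mul _ (by fun_prop) (by fun_prop)]
    have e2 : ∀ᵐ z ∂m, ((fun z => ENNReal.ofReal z) * fun z => ENNReal.ofReal (z ^ n)) z =
        ENNReal.ofReal (z ^ (n + 1)) := by
      filter_upwards [hm.ae_pos] with z hz
      rw [Pi.mul_apply, ← ENNReal.ofReal_mul hz.le, pow_succ']
    have hG1 := Real.Gamma_pos_of_pos (show 0 < 1 + ν by positivity)
    have hG2 := Real.Gamma_pos_of_pos (show 0 < ν * n + 1 by positivity)
    have hG3 := Real.Gamma_pos_of_pos hν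
    have hG4 := Real.Gamma_pos_of_pos hν1'
    have hp5 : 0 < ν + ν * n := by positivity
    have hG5 := Real.Gamma_pos_of_pos hp5
    -- The weight `z` raises the moment order to `n+1`; the factor `Γ(ν+νn)` produced here cancels
    -- against the Beta moment, leaving `n!/Γ(νn+1)`.
    have hG6 : Real.Gamma (ν * ((n + 1 : ℕ) : ℝ) + 1) = (ν + ν * n) * Real.Gamma (ν + ν * n) := by
      rw [← Real.Gamma_add_one hp5.ne']
      push_cast
      ring_nf
    rw [lintegral_congr_ae e2, hm.lintegral_pow, hm.lintegral_pow, smul_eq_mul, hG6,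
      ← ENNReal.ofReal_mul (by positivity), ← ENNReal.ofReal_mul (by positivity)]
    congr 1
    rw [beta, beta, show ν + ν * n + (1 - ν) = ν * n + 1 by ring, show ν + (1 - ν) = 1 by ring,
      Real.Gamma_one, add_comm 1 ν, Real.Gamma_add_one hν.ne', Nat.factorial_succ]
    push_cast
    field_simp
    ring

/-- The Mittag-Leffler law solves an Abel integral equation. -/
theorem integral_eq (hν : 0 < ν) (hν1 : ν < 1) (hm : IsMittagLefflerLaw ν m) {φ : ℝ → ℝ}
    (hφ : Measurable φ) (hi : Integrable φ m) :
    ν / Real.Gamma (1 - ν) *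
      ∫ v in (0 : ℝ)..1, v ^ (ν - 1) * (1 - v) ^ (-ν) * ∫ z, z * φ (z * v ^ ν) ∂m =
    ∫ z, φ z ∂m := by
  have := hm.isProbabilityMeasure
  have hν1' : 0 < 1 - ν := by linarith
  have i1 := isProbabilityMeasureBeta hν hν1'
  have i2 : IsFiniteMeasure (m.withDensity fun z => ENNReal.ofReal z) :=
    isFiniteMeasure_withDensity_ofReal hm.integrable_id.2
  have hmeas : Measurable fun p : ℝ × ℝ => p.1 * p.2 ^ ν := by fun_prop
  have hG1 := Real.Gamma_pos_of_pos (show 0 < 1 + ν by positivity)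
  have hkey := hm.map_mul_rpow_betaMeasure hν hν1
  -- Rewriting `m` as the pushforward inside `hi` itself gives the integrability that Fubini
  -- requires.
  have hi' : Integrable (fun p : ℝ × ℝ => φ (p.1 * p.2 ^ ν))
      ((m.withDensity fun z => ENNReal.ofReal z).prod (betaMeasure ν (1 - ν))) := by
    have h := hi
    rw [← hkey, integrable_smul_measure (by simpa using hG1) ENNReal.ofReal_ne_top,
      integrable_map_measure hφ.aestronglyMeasurable hmeas.aemeasurable] at h
    exact h
  conv_rhs => rw [← hkey]
  rw [integral_smul_measure, integral_map hmeas.aemeasurable hφ.aestronglyMeasurable,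
    integral_prod_symm _ hi', integral_betaMeasure hν hν1', ENNReal.toReal_ofReal hG1.le]
  have e : ∀ v : ℝ, ∫ z, φ (z * v ^ ν) ∂(m.withDensity fun z => ENNReal.ofReal z) =
      ∫ z, z * φ (z * v ^ ν) ∂m := by
    intro v
    rw [integral_withDensity_eq_integral_toReal_smul (by fun_prop)
      (ae_of_all _ fun z => ENNReal.ofReal_lt_top)]
    refine integral_congr_ae ?_
    filter_upwards [hm.ae_pos] with z hz
    rw [ENNReal.toReal_ofReal hz.le, smul_eq_mul]
  simp only [e]
  rw [show (1 : ℝ) - ν - 1 = -ν by ring, smul_eq_mul, ← mul_assoc]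
  congr 1
  rw [beta, show ν + (1 - ν) = 1 by ring, Real.Gamma_one, add_comm 1 ν, Real.Gamma_add_one hν.ne']
  have hG3 := Real.Gamma_pos_of_pos hν
  have hG4 := Real.Gamma_pos_of_pos hν1'
  field_simp

end IsMittagLefflerLaw

theorem IsStableSubordinator.isMittagLefflerLaw {Ω : Type*} [MeasurableSpace Ω] {P : Measure Ω}
    [IsProbabilityMeasure P] {ν : ℝ} {τ : ℝ≥0 → Ω → ℝ} (hν : 0 < ν)
    (hτ : IsStableSubordinator ν τ P) :
    IsMittagLefflerLaw ν (P.map fun ω => τ 1 ω ^ (-ν)) where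
  ae_pos := by
    have hm := hτ.measurable 1
    rw [ae_map_iff (by fun_prop) measurableSet_Ioi]
    filter_upwards [hτ.ae_pos hν] with ω hω using Real.rpow_pos_of_pos hω _
  lintegral_pow := hτ.lintegral_pow_eq hν

/-! ### Fractional integrals, rescaled to the unit interval. -/

theorem intervalIntegrable_beta {a b : ℝ} (ha : 0 < a) (hb : 0 < b) :
    IntervalIntegrable (fun v : ℝ => v ^ (a - 1) * (1 - v) ^ (b - 1)) volume 0 1 := by
  have h := (Complex.betaIntegral_convergent (u := a) (v := b) (by simpa) (by simpa)).norm
  rw [intervalIntegrable_iff_integrableOn_Ioo_of_le zero_le_one] at h ⊢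
  refine h.congr_fun (fun v hv => ?_) measurableSet_Ioo
  have h1 : 0 < v := hv.1
  have h2 : 0 < 1 - v := by linarith [hv.2]
  have e1 : (v : ℂ) ^ ((a : ℂ) - 1) = ((v ^ (a - 1) : ℝ) : ℂ) := by
    rw [Complex.ofReal_cpow h1.le]; push_cast; rfl
  have e2 : (1 - (v : ℂ)) ^ ((b : ℂ) - 1) = (((1 - v) ^ (b - 1) : ℝ) : ℂ) := by
    rw [Complex.ofReal_cpow h2.le]; push_cast; rfl
  simp only [e1, e2]
  rw [← Complex.ofReal_mul, Complex.norm_real, Real.norm_of_nonneg (by positivity)]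

theorem intervalIntegrable_rpow_mul_one_sub_rpow {ν : ℝ} (hν : 0 < ν) (hν1 : ν < 1) :
    IntervalIntegrable (fun v : ℝ => v ^ (ν - 1) * (1 - v) ^ (-ν)) volume 0 1 := by
  have := intervalIntegrable_beta hν (show 0 < 1 - ν by linarith)
  rwa [show (1 : ℝ) - ν - 1 = -ν by ring] at this

theorem intervalIntegrable_one_sub_rpow_mul {ν C : ℝ} (hν : 0 < ν) (hν1 : ν < 1) {g : ℝ → ℝ}
    (hg : AEStronglyMeasurable g (volume.restrict (Ioc 0 1)))
    (hC : ∀ v ∈ Ioo (0 : ℝ) 1, |g v| ≤ C * v ^ (ν - 1)) :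
    IntervalIntegrable (fun v => (1 - v) ^ (-ν) * g v) volume 0 1 := by
  have h := (intervalIntegrable_rpow_mul_one_sub_rpow hν hν1).const_mul C
  rw [intervalIntegrable_iff_integrableOn_Ioo_of_le zero_le_one] at h ⊢
  refine h.mono' ?_ ?_
  · exact (Measurable.aestronglyMeasurable (by fun_prop)).mul
      (hg.mono_measure (Measure.restrict_mono Ioo_subset_Ioc_self le_rfl))
  · filter_upwards [ae_restrict_mem measurableSet_Ioo] with v hv
    have h2 : 0 < 1 - v := by linarith [hv.2]
    have h3 : 0 < (1 - v) ^ (-ν) := Real.rpow_pos_of_pos h2 _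
    rw [norm_mul, Real.norm_of_nonneg h3.le, Real.norm_eq_abs]
    nlinarith [hC v hv]

/-- Scaling of the Abel kernel under `s = rv`: both the interval and the singularity become
independent of `r`, so that differentiation in `r` can go under the integral. -/
theorem rpow_sub_mul_eq {ν r v : ℝ} (hr : 0 < r) (hv : v ≤ 1) (f : ℝ → ℝ) :
    (r - r * v) ^ (-ν) * f (r * v) = r ^ (-ν) * ((1 - v) ^ (-ν) * f (r * v)) := by
  rw [show r - r * v = r * (1 - v) by ring, Real.mul_rpow hr.le (by linarith), mul_assoc]

theorem intervalIntegrable_sub_rpow_mul_iff {ν r : ℝ} (hr : 0 < r) (f : ℝ → ℝ) :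
    IntervalIntegrable (fun s => (r - s) ^ (-ν) * f s) volume 0 r ↔
      IntervalIntegrable (fun v => (1 - v) ^ (-ν) * f (r * v)) volume 0 1 := by
  have h := IntervalIntegrable.comp_mul_left_iff
    (f := fun s => (r - s) ^ (-ν) * f s) (a := 0) (b := r) hr.ne'
  rw [zero_div, div_self hr.ne'] at h
  rw [← h, intervalIntegrable_iff_integrableOn_Ioc_of_le zero_le_one,
    intervalIntegrable_iff_integrableOn_Ioc_of_le zero_le_one,
    integrableOn_congr_fun (fun v hv => rpow_sub_mul_eq hr hv.2 f) measurableSet_Ioc]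
  exact integrable_const_mul_iff (isUnit_iff_ne_zero.2 (Real.rpow_pos_of_pos hr _).ne') _

theorem integral_sub_rpow_mul {ν r : ℝ} (hr : 0 < r) (f : ℝ → ℝ) :
    ∫ s in (0 : ℝ)..r, (r - s) ^ (-ν) * f s =
      r ^ (1 - ν) * ∫ v in (0 : ℝ)..1, (1 - v) ^ (-ν) * f (r * v) := by
  have h := intervalIntegral.mul_integral_comp_mul_left (a := 0) (b := 1)
    (f := fun s => (r - s) ^ (-ν) * f s) r
  rw [mul_zero, mul_one] at h
  rw [← h, intervalIntegral.integral_congr (g := fun v => r ^ (-ν) * ((1 - v) ^ (-ν) * f (r * v))),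
    intervalIntegral.integral_const_mul, ← mul_assoc, sub_eq_add_neg, Real.rpow_add hr,
    Real.rpow_one]
  intro v hv
  rw [uIcc_of_le zero_le_one] at hv
  exact rpow_sub_mul_eq hr hv.2 f

section Fractional

variable {ν C : ℝ} {f : ℝ → ℝ}

theorem aestronglyMeasurable_comp_mul_left (hd : ∀ t, 0 < t → DifferentiableAt ℝ f t) {r : ℝ}
    (hr : 0 < r) : AEStronglyMeasurable (fun v => f (r * v)) (volume.restrict (Ioc 0 1)) := by
  refine ContinuousOn.aestronglyMeasurable (fun v hv => ?_) measurableSet_Ioc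
  exact ((hd (r * v) (mul_pos hr hv.1)).continuousAt.comp
    (f := fun v => r * v) (by fun_prop)).continuousWithinAt

theorem intervalIntegrable_sub_rpow_mul_deriv (hν : 0 < ν) (hν1 : ν < 1)
    (hb : ∀ t, 0 < t → |deriv f t| ≤ C * t ^ (ν - 1)) {r : ℝ} (hr : 0 < r) :
    IntervalIntegrable (fun s => (r - s) ^ (-ν) * deriv f s) volume 0 r := by
  rw [intervalIntegrable_sub_rpow_mul_iff hr]
  refine intervalIntegrable_one_sub_rpow_mul (C := C * r ^ (ν - 1)) hν hν1
    ((measurable_deriv f).comp (measurable_const_mul r)).aestronglyMeasurable fun v hv => ?_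
  refine (hb _ (mul_pos hr hv.1)).trans_eq ?_
  rw [Real.mul_rpow hr.le hv.1.le, mul_assoc]

theorem intervalIntegrable_one_sub_rpow_mul_comp (hν : 0 < ν) (hν1 : ν < 1)
    (hd : ∀ t, 0 < t → DifferentiableAt ℝ f t) (hf : ∀ t, 0 < t → |f t| ≤ C * t ^ ν) {r : ℝ}
    (hr : 0 < r) : IntervalIntegrable (fun v => (1 - v) ^ (-ν) * f (r * v)) volume 0 1 := by
  have hC : 0 ≤ C := by simpa using (abs_nonneg _).trans (hf 1 one_pos)
  refine intervalIntegrable_one_sub_rpow_mul (C := C * r ^ ν) hν hν1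
    (aestronglyMeasurable_comp_mul_left hd hr) fun v hv => ?_
  refine (hf _ (mul_pos hr hv.1)).trans ?_
  rw [Real.mul_rpow hr.le hv.1.le, ← mul_assoc]
  exact mul_le_mul_of_nonneg_left
    (Real.rpow_le_rpow_of_exponent_ge hv.1 hv.2.le (by linarith)) (by positivity)

theorem hasDerivAt_integral_one_sub_rpow_mul (hν : 0 < ν) (hν1 : ν < 1)
    (hd : ∀ t, 0 < t → DifferentiableAt ℝ f t) (hf : ∀ t, 0 < t → |f t| ≤ C * t ^ ν)
    (hb : ∀ t, 0 < t → |deriv f t| ≤ C * t ^ (ν - 1)) {t : ℝ} (ht : 0 < t) :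
    HasDerivAt (fun r => ∫ v in (0 : ℝ)..1, (1 - v) ^ (-ν) * f (r * v))
      (∫ v in (0 : ℝ)..1, (1 - v) ^ (-ν) * (v * deriv f (t * v))) t := by
  have hC : 0 ≤ C := by simpa using (abs_nonneg _).trans (hf 1 one_pos)
  -- Since `ν - 1 < 0`, keeping `r > t/2` bounds `r^(ν-1)` by a constant.
  have hnhds : Ioi (t / 2) ∈ 𝓝 t := Ioi_mem_nhds (by linarith)
  have hpos : ∀ r ∈ Ioi (t / 2), 0 < r := fun r hr => lt_trans (by positivity) hr
  refine (intervalIntegral.hasDerivAt_integral_of_dominated_loc_of_deriv_le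
    (F := fun r v => (1 - v) ^ (-ν) * f (r * v))
    (F' := fun r v => (1 - v) ^ (-ν) * (v * deriv f (r * v)))
    (bound := fun v => C * (t / 2) ^ (ν - 1) * (v ^ (ν - 1) * (1 - v) ^ (-ν)))
    hnhds ?_ (intervalIntegrable_one_sub_rpow_mul_comp hν hν1 hd hf ht) ?_ ?_
    ((intervalIntegrable_rpow_mul_one_sub_rpow hν hν1).const_mul _) ?_).2
  · filter_upwards [hnhds] with r hr
    rw [uIoc_of_le zero_le_one]
    exact (Measurable.aestronglyMeasurable (by fun_prop)).mul
      (aestronglyMeasurable_comp_mul_left hd (hpos r hr))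
  · have := measurable_deriv f
    exact Measurable.aestronglyMeasurable (by fun_prop)
  · refine ae_of_all _ fun v hv r hr => ?_
    rw [uIoc_of_le zero_le_one] at hv
    have hr0 := hpos r hr
    have h1 : 0 ≤ (1 - v) ^ (-ν) := Real.rpow_nonneg (by linarith [hv.2]) _
    have h2 : 0 ≤ v ^ (ν - 1) := Real.rpow_nonneg hv.1.le _
    have h3 : r ^ (ν - 1) ≤ (t / 2) ^ (ν - 1) :=
      Real.rpow_le_rpow_of_nonpos (by positivity) (le_of_lt hr) (by linarith)
    have h4 : |deriv f (r * v)| ≤ C * (t / 2) ^ (ν - 1) * v ^ (ν - 1) := by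
      refine (hb _ (mul_pos hr0 hv.1)).trans ?_
      rw [Real.mul_rpow hr0.le hv.1.le, ← mul_assoc]
      gcongr
    rw [norm_mul, norm_mul, Real.norm_of_nonneg h1, Real.norm_of_nonneg hv.1.le, Real.norm_eq_abs]
    calc (1 - v) ^ (-ν) * (v * |deriv f (r * v)|)
        ≤ (1 - v) ^ (-ν) * (1 * (C * (t / 2) ^ (ν - 1) * v ^ (ν - 1))) := by
          gcongr
          exact hv.2
      _ = _ := by ring
  · refine ae_of_all _ fun v hv r hr => ?_
    rw [uIoc_of_le zero_le_one] at hv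
    have h := (hd (r * v) (mul_pos (hpos r hr) hv.1)).hasDerivAt.comp r
      ((hasDerivAt_id r).mul_const v)
    refine (h.const_mul ((1 - v) ^ (-ν))).congr_deriv ?_
    ring

/-- Integration by parts with `(1-v)^(1-ν) f(tv)`, which vanishes at `0` because `f(t) = O(t^ν)` and
at `1` because `1 - ν > 0`. -/
theorem one_sub_mul_integral_one_sub_rpow_mul (hν : 0 < ν) (hν1 : ν < 1)
    (hd : ∀ t, 0 < t → DifferentiableAt ℝ f t) (hf : ∀ t, 0 < t → |f t| ≤ C * t ^ ν)
    (hb : ∀ t, 0 < t → |deriv f t| ≤ C * t ^ (ν - 1)) {t : ℝ} (ht : 0 < t) :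
    (1 - ν) * ∫ v in (0 : ℝ)..1, (1 - v) ^ (-ν) * f (t * v) =
      t * ∫ v in (0 : ℝ)..1, (1 - v) ^ (-ν) * ((1 - v) * deriv f (t * v)) := by
  have hC : 0 ≤ C := by simpa using (abs_nonneg _).trans (hf 1 one_pos)
  have i1 := intervalIntegrable_one_sub_rpow_mul_comp hν hν1 hd hf ht
  have i2 : IntervalIntegrable (fun v => (1 - v) ^ (-ν) * ((1 - v) * deriv f (t * v)))
      volume 0 1 := by
    have hm := measurable_deriv f
    refine intervalIntegrable_one_sub_rpow_mul (C := C * t ^ (ν - 1)) hν hν1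
      (Measurable.aestronglyMeasurable (by fun_prop)) fun v hv => ?_
    have h1 : 0 ≤ 1 - v := by linarith [hv.2]
    rw [abs_mul, abs_of_nonneg h1]
    calc (1 - v) * |deriv f (t * v)| ≤ 1 * |deriv f (t * v)| := by
          gcongr
          linarith [hv.1]
      _ ≤ C * (t * v) ^ (ν - 1) := by rw [one_mul]; exact hb _ (mul_pos ht hv.1)
      _ = _ := by rw [Real.mul_rpow ht.le hv.1.le, mul_assoc]
  have hderiv : ∀ v ∈ Ioo (0 : ℝ) 1, HasDerivAt (fun v => (1 - v) ^ (1 - ν) * f (t * v))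
      (t * ((1 - v) ^ (-ν) * ((1 - v) * deriv f (t * v))) -
        (1 - ν) * ((1 - v) ^ (-ν) * f (t * v))) v := by
    intro v hv
    have h1 : 0 < 1 - v := by linarith [hv.2]
    have d1 := ((hasDerivAt_id v).const_sub 1).rpow_const (p := 1 - ν) (Or.inl h1.ne')
    have d2 := (hd (t * v) (mul_pos ht hv.1)).hasDerivAt.comp v ((hasDerivAt_id v).const_mul t)
    refine (d1.mul d2).congr_deriv ?_
    simp only [id, Function.comp]
    rw [show (1 : ℝ) - ν - 1 = -ν by ring, show (1 : ℝ) - ν = -ν + 1 by ring,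
      Real.rpow_add_one h1.ne']
    ring
  have h0 : Tendsto (fun v => (1 - v) ^ (1 - ν) * f (t * v)) (𝓝[>] 0) (𝓝 0) := by
    have hl : Tendsto (fun v : ℝ => C * (t * v) ^ ν) (𝓝[>] 0) (𝓝 0) := by
      have : ContinuousAt (fun v : ℝ => C * (t * v) ^ ν) 0 :=
        continuousAt_const.mul ((by fun_prop : ContinuousAt (fun v : ℝ => t * v) 0).rpow_const
          (Or.inr hν.le))
      have h := this.tendsto.mono_left (nhdsWithin_le_nhds (s := Ioi 0))
      simpa [Real.zero_rpow hν.ne'] using h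
    refine squeeze_zero_norm' ?_ hl
    filter_upwards [Ioo_mem_nhdsGT (zero_lt_one (α := ℝ))] with v hv
    have h1 : 0 ≤ 1 - v := by linarith [hv.2]
    have h2 : (1 - v) ^ (1 - ν) ≤ 1 :=
      Real.rpow_le_one h1 (by linarith [hv.1]) (by linarith)
    rw [norm_mul, Real.norm_of_nonneg (Real.rpow_nonneg h1 _), Real.norm_eq_abs]
    calc (1 - v) ^ (1 - ν) * |f (t * v)| ≤ 1 * |f (t * v)| := by gcongr
      _ ≤ _ := by rw [one_mul]; exact hf _ (mul_pos ht hv.1)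
  have h1 : Tendsto (fun v => (1 - v) ^ (1 - ν) * f (t * v)) (𝓝[<] 1) (𝓝 0) := by
    have c1 : ContinuousAt (fun v : ℝ => (1 - v) ^ (1 - ν)) 1 :=
      (by fun_prop : ContinuousAt (fun v : ℝ => 1 - v) 1).rpow_const (Or.inr (by linarith))
    have c2 : ContinuousAt (fun v : ℝ => f (t * v)) 1 :=
      ContinuousAt.comp (g := f) (f := fun v => t * v)
        (hd (t * 1) (by positivity)).continuousAt (by fun_prop)
    have h := (c1.tendsto.mul c2.tendsto).mono_left (nhdsWithin_le_nhds (s := Iio 1))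
    simpa [Real.zero_rpow (show 1 - ν ≠ 0 by linarith)] using h
  have key := intervalIntegral.integral_eq_sub_of_hasDerivAt_of_tendsto zero_lt_one hderiv
    ((i2.const_mul t).sub (i1.const_mul (1 - ν))) h0 h1
  rw [intervalIntegral.integral_sub (i2.const_mul t) (i1.const_mul (1 - ν)),
    intervalIntegral.integral_const_mul, intervalIntegral.integral_const_mul] at key
  linarith

/-- For functions vanishing like `t ^ ν` at the origin, the Riemann--Liouville derivative is given
by the Caputo formula. -/
theorem hasDerivAt_integral_sub_rpow_mul (hν : 0 < ν) (hν1 : ν < 1)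
    (hd : ∀ t, 0 < t → DifferentiableAt ℝ f t) (hf : ∀ t, 0 < t → |f t| ≤ C * t ^ ν)
    (hb : ∀ t, 0 < t → |deriv f t| ≤ C * t ^ (ν - 1)) {t : ℝ} (ht : 0 < t) :
    HasDerivAt (fun r => ∫ s in (0 : ℝ)..r, (r - s) ^ (-ν) * f s)
      (∫ s in (0 : ℝ)..t, (t - s) ^ (-ν) * deriv f s) t := by
  have d1 : HasDerivAt (fun r : ℝ => r ^ (1 - ν)) ((1 - ν) * t ^ (1 - ν - 1)) t :=
    Real.hasDerivAt_rpow_const (Or.inl ht.ne')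
  have d2 := d1.mul (hasDerivAt_integral_one_sub_rpow_mul hν hν1 hd hf hb ht)
  have ev : (fun r => ∫ s in (0 : ℝ)..r, (r - s) ^ (-ν) * f s) =ᶠ[𝓝 t]
      ((fun r : ℝ => r ^ (1 - ν)) *
        fun r => ∫ v in (0 : ℝ)..1, (1 - v) ^ (-ν) * f (r * v)) := by
    filter_upwards [Ioi_mem_nhds ht] with r hr using integral_sub_rpow_mul hr f
  refine (d2.congr_of_eventuallyEq ev).congr_deriv ?_
  have hparts := one_sub_mul_integral_one_sub_rpow_mul hν hν1 hd hf hb ht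
  have i1 := (intervalIntegrable_sub_rpow_mul_iff ht _).1
    (intervalIntegrable_sub_rpow_mul_deriv hν hν1 hb ht)
  have i2 : IntervalIntegrable (fun v => (1 - v) ^ (-ν) * (v * deriv f (t * v))) volume 0 1 := by
    have := i1.continuousOn_mul (continuousOn_id (s := uIcc (0 : ℝ) 1))
    refine this.congr (fun v _ => ?_)
    simp only [id]
    ring
  have hsplit : ∫ v in (0 : ℝ)..1, (1 - v) ^ (-ν) * ((1 - v) * deriv f (t * v)) =
      (∫ v in (0 : ℝ)..1, (1 - v) ^ (-ν) * deriv f (t * v)) -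
        ∫ v in (0 : ℝ)..1, (1 - v) ^ (-ν) * (v * deriv f (t * v)) := by
    rw [← intervalIntegral.integral_sub i1 i2]
    refine intervalIntegral.integral_congr fun v _ => ?_
    ring
  rw [integral_sub_rpow_mul ht, show t ^ (1 - ν) = t ^ (1 - ν - 1) * t by
    rw [← Real.rpow_add_one ht.ne']; ring_nf]
  rw [hsplit] at hparts
  -- The product rule leaves `(1-ν) t^(-ν) ∫ (1-v)^(-ν) f(tv)`; integration by parts trades it for
  -- derivative terms, and the integrals carrying the factor `v` cancel.
  linear_combination t ^ (1 - ν - 1) * hparts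

end Fractional

/-! ### Time change by a Mittag-Leffler variable. -/

namespace IsMittagLefflerLaw

variable {ν C : ℝ} {m : Measure ℝ} {h k : ℝ → ℝ}

theorem integrable_comp_mul (hm : IsMittagLefflerLaw ν m) (hhm : Measurable h)
    (hh : ∀ s, 0 < s → |h s| ≤ C * s) {a : ℝ} (ha : 0 < a) :
    Integrable (fun z => h (a * z)) m := by
  refine (hm.integrable_id.const_mul (C * a)).mono' (Measurable.aestronglyMeasurable (by fun_prop)) ?_
  filter_upwards [hm.ae_pos] with z hz
  rw [mul_assoc]
  exact hh _ (mul_pos ha hz)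

theorem integrable_comp_mul_of_bounded (hm : IsMittagLefflerLaw ν m) (hkm : Measurable k)
    (hk : ∀ s, 0 < s → |k s| ≤ C) {a : ℝ} (ha : 0 < a) :
    Integrable (fun z => k (a * z)) m := by
  have := hm.isProbabilityMeasure
  refine (integrable_const C).mono' (Measurable.aestronglyMeasurable (by fun_prop)) ?_
  filter_upwards [hm.ae_pos] with z hz using hk _ (mul_pos ha hz)

theorem hasDerivAt_integral_comp (hν : 0 < ν) (hν1 : ν ≤ 1) (hm : IsMittagLefflerLaw ν m)
    (hhm : Measurable h) (hkm : Measurable k) (hhk : ∀ s, 0 < s → HasDerivAt h (k s) s)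
    (hh : ∀ s, 0 < s → |h s| ≤ C * s) (hk : ∀ s, 0 < s → |k s| ≤ C) {t : ℝ} (ht : 0 < t) :
    HasDerivAt (fun r => ∫ z, h (r ^ ν * z) ∂m)
      (ν * t ^ (ν - 1) * ∫ z, z * k (t ^ ν * z) ∂m) t := by
  have hC : 0 ≤ C := (abs_nonneg _).trans (hk 1 one_pos)
  have hnhds : Ioi (t / 2) ∈ 𝓝 t := Ioi_mem_nhds (by linarith)
  have hpos : ∀ r ∈ Ioi (t / 2), 0 < r := fun r hr => lt_trans (by positivity) hr
  refine (hasDerivAt_integral_of_dominated_loc_of_deriv_le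
    (F := fun r z => h (r ^ ν * z))
    (F' := fun r z => ν * r ^ (ν - 1) * (z * k (r ^ ν * z)))
    (bound := fun z => ν * (t / 2) ^ (ν - 1) * C * z)
    hnhds (Eventually.of_forall fun r => Measurable.aestronglyMeasurable (by fun_prop))
    (hm.integrable_comp_mul hhm hh (Real.rpow_pos_of_pos ht _))
    (Measurable.aestronglyMeasurable (by fun_prop)) ?_
    (hm.integrable_id.const_mul _) ?_).2.congr_deriv (integral_const_mul _ _)
  · filter_upwards [hm.ae_pos] with z hz r hr
    have hr0 := hpos r hr
    have h3 : r ^ (ν - 1) ≤ (t / 2) ^ (ν - 1) :=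
      Real.rpow_le_rpow_of_nonpos (by positivity) (le_of_lt hr) (by linarith)
    have h4 := hk (r ^ ν * z) (by positivity)
    rw [norm_mul, Real.norm_of_nonneg (show 0 ≤ ν * r ^ (ν - 1) by positivity), norm_mul,
      Real.norm_of_nonneg hz.le, Real.norm_eq_abs]
    calc ν * r ^ (ν - 1) * (z * |k (r ^ ν * z)|)
        ≤ ν * (t / 2) ^ (ν - 1) * (z * C) := by gcongr
      _ = _ := by ring
  · filter_upwards [hm.ae_pos] with z hz r hr
    have hr0 := hpos r hr
    have d := (hhk (r ^ ν * z) (by positivity)).comp r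
      ((Real.hasDerivAt_rpow_const (p := ν) (Or.inl hr0.ne')).mul_const z)
    refine d.congr_deriv ?_
    ring

theorem abs_integral_comp_le (hm : IsMittagLefflerLaw ν m)
    (hh : ∀ s, 0 < s → |h s| ≤ C * s) {a : ℝ} (ha : 0 < a) :
    |∫ z, h (a * z) ∂m| ≤ C * (∫ z, z ∂m) * a := by
  rw [← Real.norm_eq_abs]
  refine (norm_integral_le_of_norm_le (hm.integrable_id.const_mul (C * a)) ?_).trans_eq ?_
  · filter_upwards [hm.ae_pos] with z hz
    rw [mul_assoc]
    exact hh _ (mul_pos ha hz)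
  · rw [integral_const_mul]
    ring

theorem abs_integral_mul_comp_le (hm : IsMittagLefflerLaw ν m)
    (hk : ∀ s, 0 < s → |k s| ≤ C) {a : ℝ} (ha : 0 < a) :
    |∫ z, z * k (a * z) ∂m| ≤ C * ∫ z, z ∂m := by
  rw [← Real.norm_eq_abs]
  refine (norm_integral_le_of_norm_le (hm.integrable_id.const_mul C) ?_).trans_eq
    (integral_const_mul _ _)
  filter_upwards [hm.ae_pos] with z hz
  rw [norm_mul, Real.norm_of_nonneg hz.le, mul_comm]
  exact mul_le_mul_of_nonneg_right (hk _ (mul_pos ha hz)) hz.le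

/-- Time change by a Mittag-Leffler variable turns `d/ds` into the fractional derivative. -/
theorem hasFractionalDeriv (hν : 0 < ν) (hν1 : ν ≤ 1) (hm : IsMittagLefflerLaw ν m)
    (hhm : Measurable h) (hkm : Measurable k) (hhk : ∀ s, 0 < s → HasDerivAt h (k s) s)
    (hh : ∀ s, 0 < s → |h s| ≤ C * s) (hk : ∀ s, 0 < s → |k s| ≤ C) {f : ℝ → ℝ}
    (hf : ∀ t, 0 < t → f t = ∫ z, h (t ^ ν * z) ∂m) {t : ℝ} (ht : 0 < t) :
    HasCaputoDerivAt ν f (∫ z, k (t ^ ν * z) ∂m) t ∧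
      HasRiemannLiouvilleDerivAt ν f (∫ z, k (t ^ ν * z) ∂m) t := by
  have hd : ∀ t, 0 < t → HasDerivAt f (ν * t ^ (ν - 1) * ∫ z, z * k (t ^ ν * z) ∂m) t := by
    intro t ht
    refine (hm.hasDerivAt_integral_comp hν hν1 hhm hkm hhk hh hk ht).congr_of_eventuallyEq ?_
    filter_upwards [Ioi_mem_nhds ht] with r hr using hf r hr
  have hone : ν = 1 → HasDerivAt f (∫ z, k (t ^ ν * z) ∂m) t := by
    rintro rfl
    refine (hd t ht).congr_deriv ?_
    rw [sub_self, Real.rpow_zero, one_mul, one_mul]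
    refine integral_congr_ae ?_
    filter_upwards [hm.ae_eq_one] with z hz
    rw [hz, one_mul]
  have hC : 0 ≤ C := (abs_nonneg _).trans (hk 1 one_pos)
  have hM : 0 ≤ ∫ z, z ∂m := integral_nonneg_of_ae (hm.ae_pos.mono fun z hz => hz.le)
  have hfb : ∀ t, 0 < t → |f t| ≤ C * (∫ z, z ∂m) * t ^ ν := fun t ht => by
    rw [hf t ht]
    exact hm.abs_integral_comp_le hh (Real.rpow_pos_of_pos ht _)
  have hdb : ∀ t, 0 < t → |deriv f t| ≤ C * (∫ z, z ∂m) * t ^ (ν - 1) := fun t ht => by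
    have h1 := hm.abs_integral_mul_comp_le hk (Real.rpow_pos_of_pos ht ν)
    rw [(hd t ht).deriv, abs_mul, abs_of_nonneg (by positivity)]
    calc ν * t ^ (ν - 1) * |∫ z, z * k (t ^ ν * z) ∂m|
        ≤ 1 * t ^ (ν - 1) * (C * ∫ z, z ∂m) := by gcongr
      _ = _ := by ring
  have hval : ν < 1 → ∫ z, k (t ^ ν * z) ∂m =
      (Real.Gamma (1 - ν))⁻¹ * ∫ s in (0 : ℝ)..t, (t - s) ^ (-ν) * deriv f s := by
    intro hν1
    -- By the chain rule `f'(tv) = ν (tv)^(ν-1) E[Z k((tv)^ν Z)]`, so the Abel equation for `z ↦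
    -- k(t^ν z)` is the rescaled Caputo integral.
    have key := hm.integral_eq hν hν1 (φ := fun z => k (t ^ ν * z)) (by fun_prop)
      (hm.integrable_comp_mul_of_bounded hkm hk (Real.rpow_pos_of_pos ht _))
    rw [← key, integral_sub_rpow_mul ht, div_eq_inv_mul, mul_assoc]
    congr 1
    rw [← intervalIntegral.integral_const_mul, ← intervalIntegral.integral_const_mul,
      intervalIntegral.integral_of_le zero_le_one, intervalIntegral.integral_of_le zero_le_one]
    refine setIntegral_congr_fun measurableSet_Ioc fun v hv => ?_
    have hv0 : 0 < v := hv.1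
    have e : ∀ z, t ^ ν * (z * v ^ ν) = (t * v) ^ ν * z := fun z => by
      rw [Real.mul_rpow ht.le hv0.le]; ring
    simp only [e]
    rw [(hd (t * v) (mul_pos ht hv0)).deriv, Real.mul_rpow (z := ν - 1) ht.le hv0.le,
      show ν - 1 = -(1 - ν) by ring, Real.rpow_neg ht.le]
    have : 0 < t ^ (1 - ν) := Real.rpow_pos_of_pos ht _
    generalize (∫ z, z * k ((t * v) ^ ν * z) ∂m) = J
    field_simp
  refine ⟨⟨fun hν1 => ⟨fun s hs => (hd s hs.1).differentiableAt,
    intervalIntegrable_sub_rpow_mul_deriv hν hν1 hdb ht, hval hν1⟩, hone⟩,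
    ⟨fun hν1 => ⟨?_, ?_⟩, hone⟩⟩
  · filter_upwards [Ioi_mem_nhds ht] with r hr
    exact (intervalIntegrable_sub_rpow_mul_iff hr f).2
      (intervalIntegrable_one_sub_rpow_mul_comp hν hν1
        (fun t ht => (hd t ht).differentiableAt) hfb hr)
  · rw [hval hν1]
    exact (hasDerivAt_integral_sub_rpow_mul hν hν1
      (fun t ht => (hd t ht).differentiableAt) hfb hdb ht).const_mul _

end IsMittagLefflerLaw

/-! ### Smoothness in the space variable. -/

/-- With `u = 1/s` this is `u^p ≤ (p/a)^p e^{au}`. Uniformity in `x ≥ a` and in `s` provides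
constant dominating functions for finite measures. -/
theorem rpow_neg_mul_exp_neg_div_le {p a x s : ℝ} (hp : 0 ≤ p) (ha : 0 < a) (hx : a ≤ x)
    (hs : 0 < s) : s ^ (-p) * Real.exp (-(x / s)) ≤ (p / a) ^ p := by
  have h := rpow_abs_le_mul_exp_abs s⁻¹ hp ha.ne'
  have hs' : 0 < s⁻¹ := inv_pos.2 hs
  rw [abs_of_pos hs', abs_of_pos ha, Real.inv_rpow hs.le,
    ← Real.rpow_neg hs.le] at h
  calc s ^ (-p) * Real.exp (-(x / s))
      ≤ (p / a) ^ p * Real.exp (a * s⁻¹) * Real.exp (-(a * s⁻¹)) := by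
        gcongr
        rw [div_eq_mul_inv]
        gcongr
    _ = _ := by rw [mul_assoc, ← Real.exp_add, add_neg_cancel, Real.exp_zero, mul_one]

/-- The transform `x ↦ ∫ s^{-p} e^{-x/s} ρ(ds)`. -/
noncomputable def invLaplace (ρ : Measure ℝ) (p x : ℝ) : ℝ :=
  ∫ s, s ^ (-p) * Real.exp (-(x / s)) ∂ρ

section InvLaplace

variable {ρ : Measure ℝ} [IsFiniteMeasure ρ]

theorem integrable_rpow_neg_mul_exp (hρ : ∀ᵐ s ∂ρ, 0 < s) {p x : ℝ} (hp : 0 ≤ p) (hx : 0 < x) :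
    Integrable (fun s => s ^ (-p) * Real.exp (-(x / s))) ρ := by
  refine (integrable_const ((p / x) ^ p)).mono' (by fun_prop) ?_
  filter_upwards [hρ] with s hs
  rw [Real.norm_of_nonneg (by positivity)]
  exact rpow_neg_mul_exp_neg_div_le hp hx le_rfl hs

/-- Each derivative in `x` brings down `-1/s`, so it raises `p` by one and flips the sign;
smoothness of every order follows by induction. -/
theorem hasDerivAt_invLaplace (hρ : ∀ᵐ s ∂ρ, 0 < s) {p x : ℝ} (hp : 0 ≤ p) (hx : 0 < x) :
    HasDerivAt (invLaplace ρ p) (-invLaplace ρ (p + 1) x) x := by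
  refine (hasDerivAt_integral_of_dominated_loc_of_deriv_le
    (F := fun y s => s ^ (-p) * Real.exp (-(y / s)))
    (F' := fun y s => -(s ^ (-(p + 1)) * Real.exp (-(y / s))))
    (bound := fun _ => ((p + 1) / (x / 2)) ^ (p + 1))
    (Ioi_mem_nhds (show x / 2 < x by linarith)) (Eventually.of_forall fun r => by fun_prop)
    (integrable_rpow_neg_mul_exp hρ hp hx) (by fun_prop) ?_
    (integrable_const _) ?_).2.congr_deriv (integral_neg _)
  · filter_upwards [hρ] with s hs y hy
    rw [norm_neg, Real.norm_of_nonneg (by positivity)]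
    exact rpow_neg_mul_exp_neg_div_le (by linarith) (by positivity) (le_of_lt hy) hs
  · filter_upwards [hρ] with s hs y hy
    have d := (((hasDerivAt_id y).div_const s).neg.exp).const_mul (s ^ (-p))
    refine d.congr_deriv ?_
    rw [show -(p + 1) = -p - 1 by ring, Real.rpow_sub_one hs.ne']
    simp only [id, Pi.neg_apply]
    ring

theorem contDiffOn_invLaplace (hρ : ∀ᵐ s ∂ρ, 0 < s) (n : ℕ) {p : ℝ} (hp : 0 ≤ p) :
    ContDiffOn ℝ n (invLaplace ρ p) (Ioi 0) := by
  induction n generalizing p with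
  | zero =>
    rw [Nat.cast_zero, contDiffOn_zero]
    exact fun x hx => (hasDerivAt_invLaplace hρ hp hx).continuousAt.continuousWithinAt
  | succ n ih =>
    push_cast
    rw [contDiffOn_succ_iff_deriv_of_isOpen isOpen_Ioi]
    refine ⟨fun x hx => (hasDerivAt_invLaplace hρ hp hx).differentiableAt.differentiableWithinAt,
      by simp, ?_⟩
    exact (ih (p := p + 1) (by linarith)).neg.congr fun x hx => (hasDerivAt_invLaplace hρ hp hx).deriv

end InvLaplace

/-! ### The Gamma density and its backward equation. -/

theorem genGammaTilde_one (μ x s : ℝ) : genGammaTilde 1 μ x s =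
    x ^ (μ - 1) / Real.Gamma μ * ((s ^ μ)⁻¹ * Real.exp (-(x / s))) := by
  simp only [genGammaTilde, genGamma, div_one, Real.rpow_one, abs_one, one_mul]
  ring

theorem measurable_genGammaTilde_one (μ x : ℝ) : Measurable (genGammaTilde 1 μ x) := by
  simp only [funext (genGammaTilde_one μ x)]
  fun_prop

theorem genGammaTilde_one_of_pos {μ x s : ℝ} (hs : 0 < s) : genGammaTilde 1 μ x s =
    x ^ (μ - 1) / Real.Gamma μ * (s ^ (-μ) * Real.exp (-(x / s))) := by
  rw [genGammaTilde_one, Real.rpow_neg hs.le]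

/-- The time derivative of `genGammaTilde 1 μ x`. -/
noncomputable def genGammaTildeDeriv (μ x s : ℝ) : ℝ :=
  x ^ (μ - 1) / Real.Gamma μ * (x * (s ^ (-(μ + 2)) * Real.exp (-(x / s))) -
    μ * (s ^ (-(μ + 1)) * Real.exp (-(x / s))))

theorem measurable_genGammaTildeDeriv (μ x : ℝ) : Measurable (genGammaTildeDeriv μ x) := by
  unfold genGammaTildeDeriv
  fun_prop

theorem hasDerivAt_genGammaTilde_one {μ x s : ℝ} (hs : 0 < s) :
    HasDerivAt (genGammaTilde 1 μ x) (genGammaTildeDeriv μ x s) s := by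
  have ev : genGammaTilde 1 μ x =ᶠ[𝓝 s]
      fun s => x ^ (μ - 1) / Real.Gamma μ * (s ^ (-μ) * Real.exp (-(x / s))) := by
    filter_upwards [Ioi_mem_nhds hs] with r hr using genGammaTilde_one_of_pos hr
  have d1 : HasDerivAt (fun s : ℝ => s ^ (-μ)) (-μ * s ^ (-μ - 1)) s :=
    Real.hasDerivAt_rpow_const (Or.inl hs.ne')
  have d2 : HasDerivAt (fun s : ℝ => Real.exp (-(x / s))) (Real.exp (-(x / s)) * (x / s ^ 2)) s := by
    have d3 := ((hasDerivAt_inv hs.ne').const_mul x).neg.exp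
    simp only [Pi.neg_apply, ← div_eq_mul_inv] at d3
    refine d3.congr_deriv ?_
    field_simp
  refine (((d1.mul d2).const_mul _).congr_of_eventuallyEq ev).congr_deriv ?_
  rw [genGammaTildeDeriv, show -(μ + 2) = -μ - (2 : ℕ) by push_cast; ring,
    show -(μ + 1) = -μ - 1 by ring, Real.rpow_sub_natCast hs.ne']
  ring

theorem exists_bound_genGammaTilde {μ x : ℝ} (hμ : 0 < μ) (hx : 0 < x) :
    ∃ C, (∀ s, 0 < s → |genGammaTilde 1 μ x s| ≤ C * s) ∧
      ∀ s, 0 < s → |genGammaTildeDeriv μ x s| ≤ C := by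
  have hΓ := Real.Gamma_pos_of_pos hμ
  set c := x ^ (μ - 1) / Real.Gamma μ with hc
  have hc0 : 0 < c := by positivity
  set B₁ := ((μ + 1) / x) ^ (μ + 1)
  set B₂ := ((μ + 2) / x) ^ (μ + 2)
  have hB₁ : 0 < B₁ := by positivity
  have hB₂ : 0 < B₂ := by positivity
  have b₁ : ∀ s, 0 < s → s ^ (-(μ + 1)) * Real.exp (-(x / s)) ≤ B₁ := fun s hs =>
    rpow_neg_mul_exp_neg_div_le (by linarith) hx le_rfl hs
  have b₂ : ∀ s, 0 < s → s ^ (-(μ + 2)) * Real.exp (-(x / s)) ≤ B₂ := fun s hs =>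
    rpow_neg_mul_exp_neg_div_le (by linarith) hx le_rfl hs
  -- One constant for both bounds: the density needs `B₁` once, through `s^(-μ) = s^(-(μ+1)) s`, and
  -- its derivative needs `x B₂` and `μ B₁`.
  refine ⟨c * (x * B₂ + (μ + 1) * B₁), fun s hs => ?_, fun s hs => ?_⟩
  · rw [genGammaTilde_one_of_pos hs, abs_of_nonneg (by positivity), ← hc, mul_assoc c]
    refine mul_le_mul_of_nonneg_left ?_ hc0.le
    have e : s ^ (-μ) = s ^ (-(μ + 1)) * s := by
      rw [← Real.rpow_add_one hs.ne']; ring_nf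
    rw [e, mul_right_comm]
    refine mul_le_mul_of_nonneg_right ((b₁ s hs).trans ?_) hs.le
    nlinarith [mul_pos hx hB₂, mul_pos hμ hB₁]
  · rw [genGammaTildeDeriv, ← hc, abs_mul, abs_of_pos hc0]
    refine mul_le_mul_of_nonneg_left ?_ hc0.le
    have p1 : 0 ≤ s ^ (-(μ + 1)) * Real.exp (-(x / s)) := by positivity
    have p2 : 0 ≤ s ^ (-(μ + 2)) * Real.exp (-(x / s)) := by positivity
    have q1 := mul_le_mul_of_nonneg_left (b₁ s hs) hμ.le
    have q2 := mul_le_mul_of_nonneg_left (b₂ s hs) hx.le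
    rw [abs_le]
    constructor <;> nlinarith [mul_nonneg hx.le p2, mul_nonneg hμ.le p1, mul_pos hx hB₂]

section Space

variable {ρ : Measure ℝ} {μ : ℝ}

theorem integral_genGammaTilde_one (hρ : ∀ᵐ s ∂ρ, 0 < s) (x : ℝ) :
    ∫ s, genGammaTilde 1 μ x s ∂ρ = x ^ (μ - 1) / Real.Gamma μ * invLaplace ρ μ x := by
  rw [invLaplace, ← integral_const_mul]
  refine integral_congr_ae ?_
  filter_upwards [hρ] with s hs using genGammaTilde_one_of_pos hs

variable [IsFiniteMeasure ρ]

theorem integrable_genGammaTilde_one (hρ : ∀ᵐ s ∂ρ, 0 < s) (hμ : 0 < μ) {x : ℝ} (hx : 0 < x) :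
    Integrable (genGammaTilde 1 μ x) ρ := by
  refine ((integrable_rpow_neg_mul_exp hρ hμ.le hx).const_mul (x ^ (μ - 1) / Real.Gamma μ)).congr ?_
  filter_upwards [hρ] with s hs using (genGammaTilde_one_of_pos hs).symm

theorem contDiffOn_integral_genGammaTilde_one (hρ : ∀ᵐ s ∂ρ, 0 < s) (hμ : 0 < μ) (n : ℕ) :
    ContDiffOn ℝ n (fun x => ∫ s, genGammaTilde 1 μ x s ∂ρ) (Ioi 0) := by
  simp only [integral_genGammaTilde_one hρ]
  refine ContDiffOn.mul (ContDiffOn.div_const ?_ _) (contDiffOn_invLaplace hρ n hμ.le)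
  exact fun x hx => (Real.contDiffAt_rpow_const_of_ne (ne_of_gt hx)).contDiffWithinAt

/-- The backward equation, integrated against a law of the time variable. -/
theorem spaceOperator_integral_genGammaTilde_one (hρ : ∀ᵐ s ∂ρ, 0 < s) (hμ : 0 < μ) {x : ℝ}
    (hx : 0 < x) :
    x * iteratedDeriv 2 (fun y => ∫ s, genGammaTilde 1 μ y s ∂ρ) x -
      (μ - 2) * deriv (fun y => ∫ s, genGammaTilde 1 μ y s ∂ρ) x =
    ∫ s, genGammaTildeDeriv μ x s ∂ρ := by
  have hpow : ∀ q y : ℝ, 0 < y → HasDerivAt (fun y : ℝ => y ^ q) (q * y ^ (q - 1)) y :=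
    fun q y hy => Real.hasDerivAt_rpow_const (Or.inl hy.ne')
  have d0 : ∀ y, 0 < y → HasDerivAt (fun y => ∫ s, genGammaTilde 1 μ y s ∂ρ)
      (((μ - 1) * (y ^ (μ - 1 - 1) * invLaplace ρ μ y) -
        y ^ (μ - 1) * invLaplace ρ (μ + 1) y) / Real.Gamma μ) y := by
    intro y hy
    simp only [integral_genGammaTilde_one hρ]
    refine (((hpow (μ - 1) y hy).div_const (Real.Gamma μ)).mul
      (hasDerivAt_invLaplace hρ hμ.le hy)).congr_deriv ?_
    ring
  have d1 : HasDerivAt (fun y => ((μ - 1) * (y ^ (μ - 1 - 1) * invLaplace ρ μ y) -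
        y ^ (μ - 1) * invLaplace ρ (μ + 1) y) / Real.Gamma μ)
      (((μ - 1) * ((μ - 1 - 1) * x ^ (μ - 1 - 1 - 1) * invLaplace ρ μ x +
          x ^ (μ - 1 - 1) * -invLaplace ρ (μ + 1) x) -
        ((μ - 1) * x ^ (μ - 1 - 1) * invLaplace ρ (μ + 1) x +
          x ^ (μ - 1) * -invLaplace ρ (μ + 1 + 1) x)) / Real.Gamma μ) x :=
    ((((hpow (μ - 1 - 1) x hx).mul (hasDerivAt_invLaplace hρ hμ.le hx)).const_mul (μ - 1)).sub
      ((hpow (μ - 1) x hx).mul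
        (hasDerivAt_invLaplace hρ (show 0 ≤ μ + 1 by linarith) hx))).div_const _
  have ev : deriv (fun y => ∫ s, genGammaTilde 1 μ y s ∂ρ) =ᶠ[𝓝 x]
      fun y => ((μ - 1) * (y ^ (μ - 1 - 1) * invLaplace ρ μ y) -
        y ^ (μ - 1) * invLaplace ρ (μ + 1) y) / Real.Gamma μ := by
    filter_upwards [Ioi_mem_nhds hx] with y hy using (d0 y hy).deriv
  have hint : ∫ s, genGammaTildeDeriv μ x s ∂ρ = x ^ (μ - 1) / Real.Gamma μ *
      (x * invLaplace ρ (μ + 2) x - μ * invLaplace ρ (μ + 1) x) := by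
    simp only [genGammaTildeDeriv]
    rw [integral_const_mul, integral_sub
      ((integrable_rpow_neg_mul_exp hρ (by linarith) hx).const_mul x)
      ((integrable_rpow_neg_mul_exp hρ (by linarith) hx).const_mul μ), integral_const_mul,
      integral_const_mul]
    rfl
  rw [iteratedDeriv_succ, iteratedDeriv_one, ev.deriv_eq, d1.deriv, (d0 x hx).deriv, hint,
    show μ + 1 + 1 = μ + 2 by ring, Real.rpow_sub_one hx.ne' (μ - 1 - 1),
    Real.rpow_sub_one hx.ne' (μ - 1)]
  field_simp
  ring

end Space

/-! ### The fractional equation. -/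

theorem mainTheorem5 {Ω : Type*} [MeasurableSpace Ω] (P : Measure Ω) [IsProbabilityMeasure P]
    (ν μ : ℝ) (hν : ν ∈ Set.Ioc (0 : ℝ) 1) (hμ : 0 < μ)
    (τ : ℝ≥0 → Ω → ℝ) (hτ : IsStableSubordinator ν τ P) :
    -- the law of `L_t` and the integral that defines `ũ` are meaningful
    (∀ t : ℝ, 0 < t → AEMeasurable (inverseProcess τ t) P) ∧
    (∀ x t : ℝ, 0 < x → 0 < t → Integrable (genGammaTilde 1 μ x) (inverseLaw τ P t)) ∧
    -- `ũ` is twice continuously differentiable in space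
    (∀ t : ℝ, 0 < t → ContDiffOn ℝ 2 (fun x => uTilde 1 μ τ P x t) (Set.Ioi 0)) ∧
    -- the fractional equation, for the Caputo and for the Riemann-Liouville derivative
    (∀ x t : ℝ, 0 < x → 0 < t →
      HasCaputoDerivAt ν (fun s => uTilde 1 μ τ P x s)
        (x * iteratedDeriv 2 (fun y => uTilde 1 μ τ P y t) x
          - (μ - 2) * deriv (fun y => uTilde 1 μ τ P y t) x) t ∧
      HasRiemannLiouvilleDerivAt ν (fun s => uTilde 1 μ τ P x s)
        (x * iteratedDeriv 2 (fun y => uTilde 1 μ τ P y t) x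
          - (μ - 2) * deriv (fun y => uTilde 1 μ τ P y t) x) t) := by
  obtain ⟨hν0, hν1⟩ := hν
  have hm := hτ.isMittagLefflerLaw hν0
  have hlaw : ∀ t, 0 < t → inverseLaw τ P t = _ := fun t ht => hτ.inverseLaw_eq hν0 ht
  have hfin : ∀ t, IsProbabilityMeasure (inverseLaw τ P t) := fun t =>
    Measure.isProbabilityMeasure_map (hτ.aemeasurable_inverseProcess t)
  have hpos : ∀ t, 0 < t → ∀ᵐ s ∂(inverseLaw τ P t), 0 < s := by
    intro t ht
    rw [hlaw t ht, ae_map_iff (by fun_prop) measurableSet_Ioi]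
    filter_upwards [hm.ae_pos] with z hz using mul_pos (Real.rpow_pos_of_pos ht _) hz
  refine ⟨fun t _ => hτ.aemeasurable_inverseProcess t,
    fun x t hx ht => integrable_genGammaTilde_one (hpos t ht) hμ hx,
    fun t ht => by exact_mod_cast contDiffOn_integral_genGammaTilde_one (hpos t ht) hμ 2,
    fun x t hx ht => ?_⟩
  obtain ⟨C, hh, hk⟩ := exists_bound_genGammaTilde hμ hx
  have hspace := spaceOperator_integral_genGammaTilde_one (hpos t ht) hμ hx
  have hkm := measurable_genGammaTildeDeriv μ x
  have hhm := measurable_genGammaTilde_one μ x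
  -- The right-hand side moves to the fixed law of `Z`, the form in which the fractional derivative
  -- is computed; the second `hlaw` restores the left-hand side.
  rw [hlaw t ht, integral_map (by fun_prop) hkm.aestronglyMeasurable, ← hlaw t ht] at hspace
  change HasCaputoDerivAt ν (fun s => uTilde 1 μ τ P x s)
      (x * iteratedDeriv 2 (fun y => ∫ s, genGammaTilde 1 μ y s ∂(inverseLaw τ P t)) x -
        (μ - 2) * deriv (fun y => ∫ s, genGammaTilde 1 μ y s ∂(inverseLaw τ P t)) x) t ∧
    HasRiemannLiouvilleDerivAt ν (fun s => uTilde 1 μ τ P x s)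
      (x * iteratedDeriv 2 (fun y => ∫ s, genGammaTilde 1 μ y s ∂(inverseLaw τ P t)) x -
        (μ - 2) * deriv (fun y => ∫ s, genGammaTilde 1 μ y s ∂(inverseLaw τ P t)) x) t
  rw [hspace]
  refine hm.hasFractionalDeriv hν0 hν1 hhm hkm (fun s hs => hasDerivAt_genGammaTilde_one hs) hh hk
    (fun r hr => ?_) ht
  rw [uTilde, hlaw r hr, integral_map (by fun_prop) hhm.aestronglyMeasurable]
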